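/- Let $m\ge 1$, $n=2m+1$, let $p$ be a positive integer with $p\equiv\pm1 \pmod 8$, and let $z_j=x_j+iy_j$ $(0\le j\le n)$ be the coordinates of $\mathbb C^{n+1}$. Put $a_0=p$, $a_1=\dots=a_n=2$, $F(z)=\sum_{j=0}^n|z_j|^2$, and $$B_p=\Big\{z\in\mathbb C^{n+1}:\ F(z)=1,\ \sum_{j=0}^n z_j^{a_j}=0\Big\},\qquad \alpha=\frac14\sum_{j=0}^n a_j(x_j\,dy_j-y_j\,dx_j).$$ For $0<\epsilon_j<1$ $(j=1,\dots,m)$ let $$g_j=i(\bar z_{2j}z_{2j+1}-z_{2j}\bar z_{2j+1})=2(y_{2j}x_{2j+1}-y_{2j+1}x_{2j}),\qquad H=F+\sum_{j=1}^m\epsilon_jg_j .$$ Then $B_p$ is a regular level set of dimension $4m+1$ and $\alpha$ restricts to a contact form on it. Let $Z$ be its Reeb vector field ($\alpha(Z)=1$, $i_Zd\alpha=0$); for a smooth function $f$ on $B_p$ let $Y_f$ be the contact Hamiltonian vector field ($\alpha(Y_f)=f$, $-i_{Y_f}d\alpha=df-Z(f)\alpha$), and let $[f,g]=Y_f(g)-gZ(f)$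 be the Jacobi bracket on $B_p$. The contact flow $\dot z=Y_H$ on $B_p$ is completely integrable in the noncommutative sense, with $m+1$-dimensional generic invariant pre-isotropic tori spanned by the Reeb flow and the contact flows of $g_1,\dots,g_m$. That is, there are smooth functions $f_1,\dots,f_{3m}$ on $B_p$ such that: 1. $f_1,\dots,f_{3m}$ are integrals of $\dot z=Y_H$, $f_1=H$ on $B_p$, and $[1,f_i]=0$, $[f_i,f_j]=0$ on $B_p$ for $1\le i\le 3m$, $1\le j\le m$; the differentials of the restrictions of $f_1,\dots,f_{3m}$ to $B_p$ are linearly independent at all points of an open dense subset of $B_p$. 2. $g_1,\dots,g_m$ are integrals of $\dot z=Y_H$, and $[1,g_j]=0$, $[g_i,g_j]=0$, $[f_k,g_j]=0$ on $B_p$ for $1\le i,j\le m$, $1\le k\le 3m$. 3. For every $z\in B_p$ at which the differentials of the restrictions of $f_1,\dots,f_{3m}$ to $B_p$ are linearly independent, the connected component $T$ through $z$ of $\{w\in B_p: f_i(w)=f_i(z),\ 1\le i\le 3m\}$ is a smoothly embedded torus $\mathbb R^{m+1}/\mathbb Z^{m+1}$ of dimension $m+1$. It is pre-isotropic (it is transversal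 to $\ker\alpha$, and $d\alpha$ vanishes on $T_wT\cap\ker\alpha$ for every $w\in T$), $T_wT$ is spanned by $Z,Y_{g_1},\dots,Y_{g_m}$ for every $w\in T$, and on $T\cong\mathbb R^{m+1}/\mathbb Z^{m+1}$ the vector fields $Z$, $Y_{g_1},\dots,Y_{g_m}$ and $Y_H$ are constant (so $T$ is invariant under the flow of $Y_H$, which is quasi-periodic on it). -/

import Mathlib

open scoped ContDiff

noncomputable section

/-- A level set `M = {x | Φ x = 0}` in a real normed space `E`, together with a 1-form `α` on `E`
which is to be restricted to `M`.  (The conditions making `M` a submanifold and `α` a contact form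
on it are collected in `FormOnLevelSet.IsContact`.) -/
structure FormOnLevelSet (E V : Type*) [NormedAddCommGroup E] [NormedSpace ℝ E]
    [NormedAddCommGroup V] [NormedSpace ℝ V] where
  /-- the defining map `Φ` -/
  constraint : E → V
  /-- the 1-form `α` -/
  form : E → E →L[ℝ] ℝ

namespace FormOnLevelSet

variable {E V : Type*} [NormedAddCommGroup E] [NormedSpace ℝ E]
  [NormedAddCommGroup V] [NormedSpace ℝ V] (M : FormOnLevelSet E V)

/-- The points of `M`. -/
def carrier : Set E := {x | M.constraint x = 0}

/-- The tangent space `T_x M = ker dΦ_x` (the tangent space of a regular level set). -/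
def tangent (x : E) : Submodule ℝ E := (fderiv ℝ M.constraint x).ker

/-- The exterior derivative `dα_x(v, w) = (D_v α)(w) - (D_w α)(v)`. -/
def dform (x v w : E) : ℝ := fderiv ℝ M.form x v w - fderiv ℝ M.form x w v

/-- `M` is a regular level set of a smooth map, of dimension `2 N + 1`, and the smooth form `α`
restricts to a contact form on it: `α` does not vanish on any tangent space, and `dα` is
nondegenerate on the horizontal spaces `ker α ∩ T_x M`
(equivalently, `α ∧ (dα)^N ≠ 0` on every `T_x M`). -/
structure IsContact (N : ℕ) : Prop where
  smooth_constraint : ContDiff ℝ ∞ M.constraint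
  smooth_form : ContDiff ℝ ∞ M.form
  regular : ∀ x ∈ M.carrier, Function.Surjective (fderiv ℝ M.constraint x)
  dimension : ∀ x ∈ M.carrier, Module.finrank ℝ (M.tangent x) = 2 * N + 1
  form_ne_zero : ∀ x ∈ M.carrier, ∃ v ∈ M.tangent x, M.form x v ≠ 0
  nondegenerate : ∀ x ∈ M.carrier, ∀ v ∈ M.tangent x, M.form x v = 0 →
    (∀ w ∈ M.tangent x, M.form x w = 0 → M.dform x v w = 0) → v = 0

/-- `v` is the value at `x` of the Reeb vector field: `α(v) = 1` and `i_v dα = 0` on `T_x M`. -/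
def IsReebVector (x v : E) : Prop :=
  v ∈ M.tangent x ∧ M.form x v = 1 ∧ ∀ w ∈ M.tangent x, M.dform x v w = 0

/-- The Reeb vector field `Z` (see `reeb_spec` and `reebVector_unique`). -/
def reeb (x : E) : E := Classical.epsilon (M.IsReebVector x)

/-- `v` is the value at `x` of the contact Hamiltonian vector field
`Y_f = f Z + α^♯(df - Z(f) α)`: it is tangent to `M`, `α(v) = f`, and
`- i_v dα = df - Z(f) α` on `T_x M`. -/
def IsContactVector (f : E → ℝ) (x v : E) : Prop :=
  v ∈ M.tangent x ∧ M.form x v = f x ∧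
    ∀ w ∈ M.tangent x, - M.dform x v w = fderiv ℝ f x w - fderiv ℝ f x (M.reeb x) * M.form x w

/-- The contact Hamiltonian vector field `Y_f` on `M` of the restriction to `M` of `f`
(see `contactField_spec` and `contactVector_unique`). -/
def contactField (f : E → ℝ) (x : E) : E := Classical.epsilon (M.IsContactVector f x)

/-- The Jacobi bracket `[f, g] = Y_f(g) - g Z(f)` of functions on `M`. -/
def bracket (f g : E → ℝ) (x : E) : ℝ :=
  fderiv ℝ g x (M.contactField f x) - g x * fderiv ℝ f x (M.reeb x)

/-- `g` is a first integral on `M` of the contact Hamiltonian equation `ẋ = Y_f`. -/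
def IsIntegralOf (f g : E → ℝ) : Prop :=
  ∀ x ∈ M.carrier, fderiv ℝ g x (M.contactField f x) = 0

/-- The differentials at `x` of the restrictions of the functions `F i` to `M` are linearly
independent. -/
def IndependentAt {k : ℕ} (F : Fin k → E → ℝ) (x : E) : Prop :=
  LinearIndependent ℝ
    (fun i => ((fderiv ℝ (F i) x : E →L[ℝ] ℝ) : E →ₗ[ℝ] ℝ).comp (M.tangent x).subtype)

/-- Noncommutative integrability of the contact flow `ẋ = Y_f` on the `(2 N + 1)`-dimensional
contact manifold `M`, through the smooth integrals `F 0, …, F (k - 1)`, `k = 2 N - r`, the first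
`r` of which commute with all of them; here `f = F 0` or `f = 1` on `M`, and the integrals are
independent on an open dense subset of `M`. -/
structure IsNoncommutativelyIntegrable (N r : ℕ) (f : E → ℝ) {k : ℕ} (F : Fin k → E → ℝ) :
    Prop where
  contact : M.IsContact N
  count : k + r = 2 * N
  le : r ≤ k
  smooth : ∀ i, ContDiff ℝ ∞ (F i)
  hamiltonian : (∃ h : 0 < k, 0 < r ∧ Set.EqOn f (F ⟨0, h⟩) M.carrier) ∨
    Set.EqOn f (fun _ => 1) M.carrier
  isIntegral : ∀ i, M.IsIntegralOf f (F i)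
  bracket_one : ∀ i, ∀ x ∈ M.carrier, M.bracket (fun _ => 1) (F i) x = 0
  bracket_eq_zero : ∀ i j : Fin k, j.val < r → ∀ x ∈ M.carrier, M.bracket (F i) (F j) x = 0
  independent : ∃ U : Set E, IsOpen U ∧ M.carrier ⊆ closure (M.carrier ∩ U) ∧
    ∀ x ∈ M.carrier ∩ U, M.IndependentAt F x

/-- `φ : ℝ^d → M` induces an embedding of the torus `ℝ^d / ℤ^d` as a pre-isotropic submanifold of
`M`: a submanifold which is transversal to the horizontal distribution `ker α` and whose tangent
spaces meet it in isotropic subspaces. -/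
structure IsPreIsotropicTorus (d : ℕ) (φ : (Fin d → ℝ) → E) : Prop where
  smooth : ContDiff ℝ ∞ φ
  immersion : ∀ θ, Function.Injective (fderiv ℝ φ θ)
  eq_iff : ∀ θ θ', φ θ = φ θ' ↔ ∃ k : Fin d → ℤ, ∀ i, θ' i = θ i + k i
  mem : ∀ θ, φ θ ∈ M.carrier
  transversal : ∀ θ, ∃ u, M.form (φ θ) (fderiv ℝ φ θ u) ≠ 0
  isotropic : ∀ θ u v, M.form (φ θ) (fderiv ℝ φ θ u) = 0 → M.form (φ θ) (fderiv ℝ φ θ v) = 0 →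
    M.dform (φ θ) (fderiv ℝ φ θ u) (fderiv ℝ φ θ v) = 0

/-! ### The Reeb field and the contact Hamiltonian fields are well defined -/

variable {M}

theorem reebVector_unique {N : ℕ} (hM : M.IsContact N) {x : E} (hx : x ∈ M.carrier) {v w : E}
    (hv : M.IsReebVector x v) (hw : M.IsReebVector x w) : v = w := by
  refine sub_eq_zero.1 (hM.nondegenerate x hx _ (Submodule.sub_mem _ hv.1 hw.1) ?_ ?_)
  · rw [map_sub, hv.2.1, hw.2.1, sub_self]
  · intro u hu _
    have h1 := hv.2.2 u hu
    have h2 := hw.2.2 u hu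
    simp only [dform, map_sub, _root_.sub_apply] at *
    linarith

theorem contactVector_unique {N : ℕ} (hM : M.IsContact N) {f : E → ℝ} {x : E}
    (hx : x ∈ M.carrier) {v w : E}
    (hv : M.IsContactVector f x v) (hw : M.IsContactVector f x w) : v = w := by
  refine sub_eq_zero.1 (hM.nondegenerate x hx _ (Submodule.sub_mem _ hv.1 hw.1) ?_ ?_)
  · rw [map_sub, hv.2.1, hw.2.1, sub_self]
  · intro u hu _
    have h1 := hv.2.2 u hu
    have h2 := hw.2.2 u hu
    simp only [dform, map_sub, _root_.sub_apply] at *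
    linarith

/-- Nondegeneracy: every functional on the horizontal space is `dα(h, ·)`, `h` horizontal. -/
theorem exists_horizontal [FiniteDimensional ℝ E] {N : ℕ} (hM : M.IsContact N) {x : E}
    (hx : x ∈ M.carrier) (l : E →ₗ[ℝ] ℝ) :
    ∃ h ∈ M.tangent x, M.form x h = 0 ∧
      ∀ w ∈ M.tangent x, M.form x w = 0 → M.dform x h w = l w := by
  let H : Submodule ℝ E := M.tangent x ⊓ (M.form x).ker
  let B : H →ₗ[ℝ] (H →ₗ[ℝ] ℝ) := LinearMap.mk₂ ℝ (fun v w => M.dform x v w)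
    (by intro a b c; simp [dform]; ring) (by intro a b c; simp [dform]; ring)
    (by intro a b c; simp [dform]; ring) (by intro a b c; simp [dform]; ring)
  have hinj : Function.Injective B := by
    rw [injective_iff_map_eq_zero]
    intro v hv
    apply Subtype.ext
    refine hM.nondegenerate x hx v v.2.1 v.2.2 ?_
    intro w hw hw0
    exact congrArg (fun L : H →ₗ[ℝ] ℝ => L ⟨w, hw, hw0⟩) hv
  have hsurj : Function.Surjective B :=
    (LinearMap.injective_iff_surjective_of_finrank_eq_finrank
      (Subspace.dual_finrank_eq (K := ℝ) (V := H)).symm).1 hinj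
  obtain ⟨h, hh⟩ := hsurj (l.comp H.subtype)
  refine ⟨h, h.2.1, h.2.2, fun w hw hw0 => ?_⟩
  exact congrArg (fun L : H →ₗ[ℝ] ℝ => L ⟨w, hw, hw0⟩) hh

theorem reeb_spec [FiniteDimensional ℝ E] {N : ℕ} (hM : M.IsContact N) {x : E}
    (hx : x ∈ M.carrier) : M.IsReebVector x (M.reeb x) := by
  apply Classical.epsilon_spec (p := M.IsReebVector x)
  obtain ⟨v, hv, hv0⟩ := hM.form_ne_zero x hx
  let l : E →ₗ[ℝ] ℝ :=
    { toFun := fun w => - M.dform x v w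
      map_add' := by intro a b; simp [dform]; ring
      map_smul' := by intro a b; simp [dform]; ring }
  obtain ⟨h, hh, hh0, hhl⟩ := exists_horizontal hM hx l
  have key : ∀ w ∈ M.tangent x, M.form x w = 0 → M.dform x (v + h) w = 0 := by
    intro w hw hw0
    have h1 : M.dform x h w = - M.dform x v w := hhl w hw hw0
    simp only [dform, map_add, _root_.add_apply] at *
    linarith
  refine ⟨(M.form x v)⁻¹ • (v + h), Submodule.smul_mem _ _ (Submodule.add_mem _ hv hh), ?_, ?_⟩
  · simp [hh0, hv0]
  · intro w hw
    have h2 := key (w - (M.form x w / M.form x v) • (v + h))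
      (Submodule.sub_mem _ hw (Submodule.smul_mem _ _ (Submodule.add_mem _ hv hh)))
      (by simp [hh0, hv0])
    have h3 : M.dform x (v + h) w = 0 := by
      simp only [dform, map_sub, map_smul, _root_.sub_apply,
        _root_.smul_apply, smul_eq_mul] at *
      linarith
    simp only [dform, map_smul, _root_.smul_apply, smul_eq_mul] at *
    rw [← mul_sub, h3, mul_zero]

theorem contactField_spec [FiniteDimensional ℝ E] {N : ℕ} (hM : M.IsContact N) (f : E → ℝ) {x : E}
    (hx : x ∈ M.carrier) : M.IsContactVector f x (M.contactField f x) := by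
  apply Classical.epsilon_spec (p := M.IsContactVector f x)
  obtain ⟨hZ, hZ1, hZ2⟩ := reeb_spec hM hx
  obtain ⟨h, hh, hh0, hhl⟩ := exists_horizontal hM hx
    (-((fderiv ℝ f x : E →L[ℝ] ℝ) : E →ₗ[ℝ] ℝ))
  refine ⟨f x • M.reeb x + h, Submodule.add_mem _ (Submodule.smul_mem _ _ hZ) hh, ?_, ?_⟩
  · simp [hZ1, hh0]
  · intro w hw
    have h1 := hZ2 w hw
    have h2 := hZ2 h hh
    have h3 := hhl (w - M.form x w • M.reeb x)
      (Submodule.sub_mem _ hw (Submodule.smul_mem _ _ hZ)) (by simp [hZ1])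
    simp only [dform, map_sub, map_add, map_smul, _root_.sub_apply,
      _root_.add_apply, _root_.smul_apply, smul_eq_mul,
      LinearMap.neg_apply, ContinuousLinearMap.coe_coe] at *
    linear_combination (-(f x)) * h1 + M.form x w * h2 - h3

end FormOnLevelSet

/-! ### Brieskorn manifolds -/

/-- `F(z) = ∑ |z_j|²`. -/
def sqNorm {ι : Type*} [Fintype ι] (z : ι → ℂ) : ℝ := ∑ j, Complex.normSq (z j)

/-- `α = (1/4) ∑ a_j (x_j dy_j - y_j dx_j)`, where `z_j = x_j + i y_j`. -/
def brieskornForm {ι : Type*} [Fintype ι] (a : ι → ℕ) (z : ι → ℂ) : (ι → ℂ) →L[ℝ] ℝ :=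
  (1 / 4 : ℝ) • ∑ j, (a j : ℝ) •
    ((z j).re • Complex.imCLM.comp (ContinuousLinearMap.proj (R := ℝ) (φ := fun _ : ι => ℂ) j) -
      (z j).im • Complex.reCLM.comp (ContinuousLinearMap.proj (R := ℝ) (φ := fun _ : ι => ℂ) j))

/-- The Brieskorn manifold `{z | ∑ |z_j|² = 1, ∑ z_j ^ a_j = 0}` with its form `α`. -/
def brieskorn {ι : Type*} [Fintype ι] (a : ι → ℕ) : FormOnLevelSet (ι → ℂ) (ℝ × ℂ) where
  constraint := fun z => (sqNorm z - 1, ∑ j, z j ^ a j)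
  form := brieskornForm a

/-- The Brieskorn manifold `B_p` in `ℂ^(n+1)`, `n = 2 m + 1`, with exponents
`a_0 = p`, `a_1 = ⋯ = a_n = 2`. -/
def ustilovsky (m p : ℕ) : FormOnLevelSet (Fin (2 * m + 2) → ℂ) (ℝ × ℂ) :=
  brieskorn (fun j => if j = 0 then p else 2)

/-- `g_j = i (z̄_{2j} z_{2j+1} - z_{2j} z̄_{2j+1}) = 2 (y_{2j} x_{2j+1} - y_{2j+1} x_{2j})`,
for `j = 1, …, m`; the index `j : Fin m` of Lean stands for `j + 1`. -/
def ustilovskyG {m : ℕ} (j : Fin m) (z : Fin (2 * m + 2) → ℂ) : ℝ :=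
  2 * ((z ⟨2 * (j + 1), by omega⟩).im * (z ⟨2 * (j + 1) + 1, by omega⟩).re -
    (z ⟨2 * (j + 1) + 1, by omega⟩).im * (z ⟨2 * (j + 1), by omega⟩).re)

/-- `H = F + ∑ ε_j g_j`. -/
def ustilovskyH {m : ℕ} (ε : Fin m → ℝ) (z : Fin (2 * m + 2) → ℂ) : ℝ :=
  sqNorm z + ∑ j, ε j * ustilovskyG j z

end

/-! The Reeb flow multiplies `z 0` by exp(4it/p) and the other coordinates by exp(2it). The contact
flow of g_j is the real rotation of the j-th pair by the angle 2t. These flows commute and form a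
linear action of ℝ^(m+1) (`torusAction`) preserving B_p. Since F = 1 on B_p, Y_H = Z + ∑ ε_j
Y_{g_j}, so Y_H is a fundamental field of this action (`contactField_ustilovskyH`). Hence every
invariant function is an integral of Y_H. It also commutes with 1, with H and with all g_j, because
[f, g] = -[g, f] for functions invariant under the Reeb flow.

The 3m invariants are H, the g_j, the squared norms and phases of the pairs, and |z_1|². H replaces
the first g_j, which is possible because the first ε is nonzero, and |z_1|² replaces the phase of
the first pair. A relation between their differentials on a tangent space is a Lagrange multiplier
relation on ℂ^(2m+2). Testing it on vectors that turn or stretch one factor of z_{2j}² + z_{2j+1}² =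
(z_{2j} + i z_{2j+1})(z_{2j} - i z_{2j+1}) shows that all coefficients vanish on `genericSet`
(`coeff_eq_zero_of_generic`). Density of this set is proved on the cone ∑ z_k^{a_k} = 0: there a
coordinate can be moved freely while a pair moves along an isotropic direction to compensate.
Weighted scaling brings the result back to the sphere (`carrier_subset_closure_generic`).

At any point where the integrals are independent, the dg_j are independent on the tangent space. As
dα(X_v, ·) = -∑ v_j dg_j there, the action is infinitesimally free. Since (4m+1) - 3m = m+1, the
common kernel of the differentials is the tangent space of the orbit, so the orbit is open in the
level set (`eventually_mem_orbit`). The stabiliser is discrete and contains a period on each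
coordinate axis, so it is a full lattice and the orbit is a compact torus (`exists_basis_orbit`).
Being open, closed and connected in the level set, it is the connected component
(`range_orbit_eq_connectedComponentIn`). It is pre-isotropic because the g_j are constant on it. -/

open scoped ContDiff

noncomputable section

open Filter Topology Module

/-! ### Linear functionals and kernels -/

section Linear

variable {E W : Type*} [AddCommGroup E] [Module ℝ E] [AddCommGroup W] [Module ℝ W]

/-- A functional which vanishes on the kernel of `L` factors through `L`. -/
theorem exists_eq_comp_of_forall_ker (L : E →ₗ[ℝ] W) (l : E →ₗ[ℝ] ℝ)
    (h : ∀ v, L v = 0 → l v = 0) : ∃ f : W →ₗ[ℝ] ℝ, ∀ v, l v = f (L v) := by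
  have hl : l ∈ (LinearMap.ker L).dualAnnihilator := by
    rw [Submodule.mem_dualAnnihilator]
    exact fun v hv => h v hv
  rw [← LinearMap.range_dualMap_eq_dualAnnihilator_ker] at hl
  obtain ⟨f, rfl⟩ := hl
  exact ⟨f, fun v => rfl⟩

/-- Every real functional on `ℝ × ℂ` is of the form `(s, c) ↦ λ s + Re (μ c)`. -/
theorem exists_real_complex_functional (f : ℝ × ℂ →ₗ[ℝ] ℝ) :
    ∃ (l : ℝ) (μ : ℂ), ∀ s c, f (s, c) = l * s + (μ * c).re := by
  -- The minus sign comes from Re (μ i) = -Im μ.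
  refine ⟨f (1, 0), ⟨f (0, 1), -f (0, Complex.I)⟩, fun s c => ?_⟩
  have h : ((s, c) : ℝ × ℂ) = s • ((1 : ℝ), (0 : ℂ)) + c.re • ((0 : ℝ), (1 : ℂ)) +
      c.im • ((0 : ℝ), Complex.I) := by
    ext <;> simp
  rw [h, map_add, map_add, map_smul, map_smul, map_smul]
  simp
  ring

/-- The common kernel of `k` linearly independent functionals has codimension `k`. -/
theorem LinearIndependent.finrank_dualCoannihilator [FiniteDimensional ℝ E] {k : ℕ}
    {l : Fin k → E →ₗ[ℝ] ℝ} (hl : LinearIndependent ℝ l) :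
    k + finrank ℝ (Submodule.span ℝ (Set.range l)).dualCoannihilator = finrank ℝ E := by
  have h := Subspace.finrank_add_finrank_dualCoannihilator_eq (Submodule.span ℝ (Set.range l))
  rwa [finrank_span_eq_card hl, Fintype.card_fin] at h

end Linear

/-! ### Local structure of fibres, from the inverse function theorem -/

section Fibre

variable {E W P : Type*} [NormedAddCommGroup E] [NormedSpace ℝ E] [FiniteDimensional ℝ E]
  [NormedAddCommGroup W] [NormedSpace ℝ W] [FiniteDimensional ℝ W]
  [NormedAddCommGroup P] [NormedSpace ℝ P] [FiniteDimensional ℝ P]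

/-- A map with injective strict derivative at a point is injective near it. -/
theorem HasStrictFDerivAt.exists_injOn {f : E → W} {f' : E →L[ℝ] W} {a : E}
    (hf : HasStrictFDerivAt f f' a) (hinj : Function.Injective f') :
    ∃ U ∈ 𝓝 a, Set.InjOn f U := by
  -- Composing `f` with a linear left inverse of `f'` gives a map with derivative the identity; it
  -- is injective near `a`, hence so is `f`.
  obtain ⟨g, hg⟩ := (f' : E →ₗ[ℝ] W).exists_leftInverse_of_injective
    (LinearMap.ker_eq_bot.2 hinj)
  have : CompleteSpace E := FiniteDimensional.complete ℝ E
  let gc : W →L[ℝ] E := LinearMap.toContinuousLinearMap g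
  have hcomp : gc.comp f' = (ContinuousLinearEquiv.refl ℝ E : E →L[ℝ] E) := by
    ext v
    exact LinearMap.congr_fun hg v
  have h := gc.hasStrictFDerivAt.comp a hf
  rw [hcomp] at h
  refine ⟨(h.toOpenPartialHomeomorph _).source, (h.toOpenPartialHomeomorph _).open_source.mem_nhds
    h.mem_toOpenPartialHomeomorph_source, fun x hx y hy hxy => ?_⟩
  refine (h.toOpenPartialHomeomorph _).injOn hx hy ?_
  simp [hxy]

/-- If an immersion `φ` maps to a fibre of `G` and its tangent space at a point contains
`ker dG`, then near that point the fibre is contained in the image of `φ`. -/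
theorem HasStrictFDerivAt.eventually_mem_range_of_fibre {G : E → W} {φ : P → E}
    {G' : E →L[ℝ] W} {D : P →L[ℝ] E} {t : P}
    (hG : HasStrictFDerivAt G G' (φ t)) (hφ : HasStrictFDerivAt φ D t)
    (hD : Function.Injective D) (hker : ∀ v, G' v = 0 → ∃ s, D s = v)
    (hconst : ∀ s, G (φ s) = G (φ t)) :
    ∀ᶠ w in 𝓝 (φ t), G w = G (φ t) → w ∈ Set.range φ := by
  obtain ⟨g, hg⟩ := (D : P →ₗ[ℝ] E).exists_leftInverse_of_injective (LinearMap.ker_eq_bot.2 hD)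
  have : CompleteSpace E := FiniteDimensional.complete ℝ E
  have : CompleteSpace P := FiniteDimensional.complete ℝ P
  let gc : E →L[ℝ] P := LinearMap.toContinuousLinearMap g
  have hgD : ∀ s, gc (D s) = s := fun s => LinearMap.congr_fun hg s
  -- The pair (`G`, `gc`) has injective derivative: the kernel of `G'` lies in the range of `D`, on
  -- which `gc` is injective.
  have h1 := hG.prodMk (gc.hasStrictFDerivAt (x := φ t))
  have hinj : Function.Injective (G'.prod gc) := by
    rw [injective_iff_map_eq_zero]
    intro v hv
    obtain ⟨hv1, hv2⟩ := Prod.ext_iff.1 hv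
    obtain ⟨s, rfl⟩ := hker v hv1
    have : gc (D s) = 0 := hv2
    rw [hgD] at this
    rw [this, map_zero]
  obtain ⟨U, hU, hinjU⟩ := h1.exists_injOn hinj
  -- `gc ∘ φ` has derivative the identity, so it reaches every value near `gc (φ t)`. A nearby `w`
  -- in the fibre then shares both `G` and `gc` with some `φ s`, which forces `w = φ s`.
  have h2 := (gc.hasStrictFDerivAt (x := φ t)).comp t hφ
  have hcomp : gc.comp D = (ContinuousLinearEquiv.refl ℝ P : P →L[ℝ] P) := by
    ext s
    exact hgD s
  rw [hcomp] at h2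
  have hmap := h2.map_nhds_eq_of_equiv
  have hN : φ ⁻¹' U ∈ 𝓝 t := hφ.continuousAt.preimage_mem_nhds hU
  have hN' : (fun x => gc (φ x)) '' (φ ⁻¹' U) ∈ 𝓝 (gc (φ t)) := by
    rw [← hmap]
    exact image_mem_map hN
  filter_upwards [hU, gc.continuous.continuousAt.preimage_mem_nhds hN'] with w hw hw' hGw
  obtain ⟨s, hs, hsw⟩ := hw'
  refine ⟨s, hinjU hs hw ?_⟩
  exact Prod.ext ((hconst s).trans hGw.symm) hsw

end Fibre

/-! ### Orbits of linear actions of ℝ^d -/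

section Orbit

variable {E : Type*} [NormedAddCommGroup E] [NormedSpace ℝ E] {d : ℕ}

/-- The stabiliser of a point under a linear action of `ℝ^d`, as a `ℤ`-submodule. -/
def stabilizerLattice (A : (Fin d → ℝ) → E →L[ℝ] E) (h0 : A 0 = ContinuousLinearMap.id ℝ E)
    (hadd : ∀ s t, A (s + t) = (A s).comp (A t)) (z : E) : Submodule ℤ (Fin d → ℝ) :=
  AddSubgroup.toIntSubmodule
    { carrier := {t | A t z = z}
      zero_mem' := by simp [h0]
      add_mem' := by
        intro s t hs ht
        simp only [Set.mem_ofPred_eq] at *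
        rw [hadd, ContinuousLinearMap.comp_apply, ht, hs]
      neg_mem' := by
        intro t ht
        simp only [Set.mem_ofPred_eq] at *
        have h : A (-t) (A t z) = z := by
          rw [← ContinuousLinearMap.comp_apply, ← hadd, neg_add_cancel, h0]
          rfl
        rwa [ht] at h }

variable {A : (Fin d → ℝ) → E →L[ℝ] E} (h0 : A 0 = ContinuousLinearMap.id ℝ E)
  (hadd : ∀ s t, A (s + t) = (A s).comp (A t)) {z : E}

/-- The stabiliser is discrete if the orbit map is an immersion at `0`. -/
theorem discreteTopology_stabilizerLattice [FiniteDimensional ℝ E] {D : (Fin d → ℝ) →L[ℝ] E}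
    (hφ : HasStrictFDerivAt (fun t => A t z) D 0) (hD : Function.Injective D) :
    DiscreteTopology (stabilizerLattice A h0 hadd z) := by
  obtain ⟨U, hU, hinj⟩ := hφ.exists_injOn hD
  obtain ⟨V, hVU, hV, h0V⟩ := mem_nhds_iff.1 hU
  refine discreteTopology_iff_isOpen_singleton_zero.mpr ⟨V, hV, ?_⟩
  ext t
  simp only [Set.mem_preimage, Set.mem_singleton_iff]
  constructor
  · intro ht
    apply Subtype.ext
    refine hinj (hVU ht) (hVU h0V) ?_
    have h1 : A t z = z := t.2
    simp [h1, h0]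
  · rintro rfl
    exact h0V

/-- A closed orbit which is open in an invariant set is a connected component of this set. -/
theorem range_orbit_eq_connectedComponentIn {S : Set E} (hz : z ∈ S)
    (hS : ∀ t, ∀ w ∈ S, A t w ∈ S) (hcont : Continuous fun t => A t z)
    (hclosed : IsClosed (Set.range fun t => A t z))
    (hloc : ∀ᶠ w in 𝓝 z, w ∈ S → w ∈ Set.range fun t => A t z)
    (h0 : A 0 = ContinuousLinearMap.id ℝ E) (hadd : ∀ s t, A (s + t) = (A s).comp (A t)) :
    (Set.range fun t => A t z) = connectedComponentIn S z := by
  set O := Set.range fun t => A t z with hO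
  have hzO : z ∈ O := ⟨0, by simp [h0]⟩
  have hneg : ∀ t w, A t (A (-t) w) = w := by
    intro t w
    rw [← ContinuousLinearMap.comp_apply, ← hadd, add_neg_cancel, h0]
    rfl
  have hneg' : ∀ t w, A (-t) (A t w) = w := by
    intro t w
    rw [← ContinuousLinearMap.comp_apply, ← hadd, neg_add_cancel, h0]
    rfl
  obtain ⟨U, hUO, hU, hzU⟩ := mem_nhds_iff.1 hloc
  apply Set.Subset.antisymm
  · apply IsPreconnected.subset_connectedComponentIn
    · rw [hO, ← Set.image_univ]
      exact isPreconnected_univ.image _ hcont.continuousOn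
    · exact hzO
    · rintro _ ⟨t, rfl⟩
      exact hS t z hz
  -- Invariance spreads the local statement at `z` along the orbit: inside `S` the open set `V`
  -- meets nothing but the orbit. So `V` and the complement of the closed orbit would disconnect the
  -- component if it were larger.
  · let V : Set E := ⋃ t, (A t) ⁻¹' U
    have hV : IsOpen V := isOpen_iUnion fun t => hU.preimage (A t).continuous
    have hVS : ∀ w ∈ S, w ∈ V → w ∈ O := by
      intro w hw hwV
      obtain ⟨t, ht⟩ := Set.mem_iUnion.1 hwV
      obtain ⟨s, hs⟩ := hUO ht (hS t w hw)
      refine ⟨-t + s, ?_⟩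
      simp only at hs ⊢
      rw [hadd, ContinuousLinearMap.comp_apply, hs, hneg']
    have hOV : O ⊆ V := by
      rintro _ ⟨t, rfl⟩
      refine Set.mem_iUnion.2 ⟨-t, ?_⟩
      simpa [hneg'] using hzU
    have hcS : connectedComponentIn S z ⊆ S := connectedComponentIn_subset S z
    have hdisj : ∀ w ∈ S, w ∈ V ∨ w ∈ Oᶜ := by
      intro w _
      by_cases hw : w ∈ O
      · exact Or.inl (hOV hw)
      · exact Or.inr hw
    intro w hw
    by_contra hwO
    obtain ⟨x, hx, hxV, hxO⟩ := isPreconnected_connectedComponentIn V Oᶜ hV hclosed.isOpen_compl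
      (fun y hy => hdisj y (hcS hy)) ⟨z, mem_connectedComponentIn hz, hOV hzO⟩ ⟨w, hw, hwO⟩
    exact hxO (hVS x (hcS hx) hxV)

/-- If the stabiliser is a full lattice, then its `ℤ`-bases exhibit the orbit as an embedded
compact torus. -/
theorem exists_basis_orbit [FiniteDimensional ℝ E] {D : (Fin d → ℝ) →L[ℝ] E}
    (h0 : A 0 = ContinuousLinearMap.id ℝ E) (hadd : ∀ s t, A (s + t) = (A s).comp (A t))
    (hφ : HasStrictFDerivAt (fun t => A t z) D 0) (hD : Function.Injective D)
    (hcont : Continuous fun t => A t z)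
    (c : Fin d → ℝ) (hc : ∀ i, c i ≠ 0) (hper : ∀ i, A (Pi.single i (c i)) z = z) :
    IsCompact (Set.range fun t => A t z) ∧ ∃ b : Basis (Fin d) ℝ (Fin d → ℝ),
      ∀ t, A t z = z ↔ ∃ k : Fin d → ℤ, ∀ i, b.repr t i = k i := by
  let L := stabilizerLattice A h0 hadd z
  have hdisc : DiscreteTopology L := discreteTopology_stabilizerLattice h0 hadd hφ hD
  -- The periods on the coordinate axes already span; they need not generate the stabiliser.
  have hspan : Submodule.span ℝ (L : Set (Fin d → ℝ)) = ⊤ := by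
    rw [eq_top_iff]
    intro t _
    rw [pi_eq_sum_univ' t]
    refine Submodule.sum_mem _ fun i _ => ?_
    have h : t i • (Pi.single i 1 : Fin d → ℝ) = (t i / c i) • Pi.single i (c i) := by
      rw [← Pi.single_smul, ← Pi.single_smul]
      simp [hc i]
    rw [h]
    exact Submodule.smul_mem _ _ (Submodule.subset_span (hper i))
  have hlat : IsZLattice ℝ L := ⟨hspan⟩
  refine ⟨IsZLattice.isCompact_range_of_periodic L _ hcont fun s t ht => ?_,
    (IsZLattice.basis L).ofZLatticeBasis ℝ L, fun t => ?_⟩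
  · have h1 : A t z = z := ht
    rw [hadd, ContinuousLinearMap.comp_apply, h1]
  · constructor
    · intro ht
      exact ⟨fun i => (IsZLattice.basis L).repr ⟨t, ht⟩ i, fun i =>
        (IsZLattice.basis L).ofZLatticeBasis_repr_apply ℝ L ⟨t, ht⟩ i⟩
    · rintro ⟨k, hk⟩
      have h1 : t = ∑ i, k i • ((IsZLattice.basis L i : L) : Fin d → ℝ) := by
        conv_lhs => rw [← ((IsZLattice.basis L).ofZLatticeBasis ℝ L).sum_repr t]
        refine Finset.sum_congr rfl fun i _ => ?_
        rw [hk i, Basis.ofZLatticeBasis_apply, Int.cast_smul_eq_zsmul]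
      have h2 : t ∈ L := by
        rw [h1]
        exact Submodule.sum_mem _ fun i _ => Submodule.smul_mem _ _ (Subtype.property _)
      exact h2

end Orbit

/-! ### Contact geometry of Brieskorn manifolds -/

section Brieskorn

open ComplexConjugate Module

variable {ι : Type*} [Fintype ι]

theorem brieskornForm_apply (a : ι → ℕ) (z v : ι → ℂ) :
    brieskornForm a z v = 1 / 4 * ∑ j, (a j : ℝ) * ((z j).re * (v j).im - (z j).im * (v j).re) := by
  simp [brieskornForm]

/-- The Brieskorn form depends linearly on the base point. -/
def brieskornFormL (a : ι → ℕ) : (ι → ℂ) →L[ℝ] (ι → ℂ) →L[ℝ] ℝ :=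
  LinearMap.toContinuousLinearMap
    { toFun := brieskornForm a
      map_add' := by
        intro z w
        ext v
        simp only [brieskornForm_apply, Pi.add_apply, Complex.add_re, Complex.add_im,
          _root_.add_apply]
        rw [← mul_add, ← Finset.sum_add_distrib]
        congr 1
        exact Finset.sum_congr rfl fun j _ => by ring
      map_smul' := by
        intro c z
        ext v
        simp only [brieskornForm_apply, Pi.smul_apply, Complex.real_smul, Complex.re_ofReal_mul,
          Complex.im_ofReal_mul, _root_.smul_apply, smul_eq_mul, RingHom.id_apply]
        rw [mul_left_comm, Finset.mul_sum (a := c)]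
        congr 1
        exact Finset.sum_congr rfl fun j _ => by ring }

theorem brieskornFormL_eq (a : ι → ℕ) : ⇑(brieskornFormL a) = brieskornForm a := rfl

theorem brieskorn_form (a : ι → ℕ) (z v : ι → ℂ) : (brieskorn a).form z v =
    1 / 4 * ∑ j, (a j : ℝ) * ((z j).re * (v j).im - (z j).im * (v j).re) :=
  brieskornForm_apply a z v

/-- The form is linear in the base point, so dα is constant: it is the antisymmetrisation of a
bilinear form. -/
theorem brieskorn_dform (a : ι → ℕ) (z v w : ι → ℂ) : (brieskorn a).dform z v w =
    1 / 2 * ∑ j, (a j : ℝ) * ((v j).re * (w j).im - (v j).im * (w j).re) := by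
  have h : fderiv ℝ (brieskorn a).form z = brieskornFormL a := by
    rw [show (brieskorn a).form = brieskornFormL a from rfl]
    exact (brieskornFormL a).fderiv
  rw [FormOnLevelSet.dform, h, brieskornFormL_eq, brieskornForm_apply, brieskornForm_apply,
    ← mul_sub, ← Finset.sum_sub_distrib, Finset.mul_sum, Finset.mul_sum]
  exact Finset.sum_congr rfl fun j _ => by ring

theorem hasFDerivAt_sqNorm (z : ι → ℂ) : HasFDerivAt sqNorm
    ((2 : ℝ) • ∑ j, ((z j).re • Complex.reCLM.comp
        (ContinuousLinearMap.proj (R := ℝ) (φ := fun _ : ι => ℂ) j) +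
      (z j).im • Complex.imCLM.comp
        (ContinuousLinearMap.proj (R := ℝ) (φ := fun _ : ι => ℂ) j))) z := by
  have h : ∀ j ∈ (Finset.univ : Finset ι), HasFDerivAt (fun z : ι → ℂ => Complex.normSq (z j))
      ((2 : ℝ) • ((z j).re • Complex.reCLM.comp
        (ContinuousLinearMap.proj (R := ℝ) (φ := fun _ : ι => ℂ) j) +
      (z j).im • Complex.imCLM.comp
        (ContinuousLinearMap.proj (R := ℝ) (φ := fun _ : ι => ℂ) j))) z := by
    intro j _
    have hr := (Complex.reCLM.comp
      (ContinuousLinearMap.proj (R := ℝ) (φ := fun _ : ι => ℂ) j)).hasFDerivAt (x := z)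
    have hi := (Complex.imCLM.comp
      (ContinuousLinearMap.proj (R := ℝ) (φ := fun _ : ι => ℂ) j)).hasFDerivAt (x := z)
    refine ((hr.mul hr).add (hi.mul hi)).congr_fderiv ?_
    ext v
    simp
    ring
  have h2 := HasFDerivAt.fun_sum h
  rw [← Finset.smul_sum] at h2
  exact h2

theorem fderiv_sqNorm (z v : ι → ℂ) : fderiv ℝ sqNorm z v =
    2 * ∑ j, ((z j).re * (v j).re + (z j).im * (v j).im) := by
  rw [(hasFDerivAt_sqNorm z).fderiv]
  simp

theorem contDiff_sqNorm : ContDiff ℝ ∞ (sqNorm : (ι → ℂ) → ℝ) := by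
  unfold sqNorm
  simp only [Complex.normSq_apply]
  have hr : ∀ j, ContDiff ℝ ∞ fun z : ι → ℂ => (z j).re := fun j =>
    (Complex.reCLM.comp (ContinuousLinearMap.proj (R := ℝ) (φ := fun _ : ι => ℂ) j)).contDiff
  have hi : ∀ j, ContDiff ℝ ∞ fun z : ι → ℂ => (z j).im := fun j =>
    (Complex.imCLM.comp (ContinuousLinearMap.proj (R := ℝ) (φ := fun _ : ι => ℂ) j)).contDiff
  exact ContDiff.sum fun j _ => ((hr j).mul (hr j)).add ((hi j).mul (hi j))

theorem hasFDerivAt_brieskornPoly (a : ι → ℕ) (z : ι → ℂ) :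
    HasFDerivAt (fun z : ι → ℂ => ∑ j, z j ^ a j)
      (∑ j, ((a j : ℂ) * z j ^ (a j - 1)) •
        ContinuousLinearMap.proj (R := ℝ) (φ := fun _ : ι => ℂ) j) z := by
  refine HasFDerivAt.fun_sum fun j _ => ?_
  have h := ((ContinuousLinearMap.proj (R := ℝ) (φ := fun _ : ι => ℂ) j).hasFDerivAt (x := z)).pow
    (a j)
  refine h.congr_fderiv ?_
  ext v
  simp

theorem contDiff_brieskorn_constraint (a : ι → ℕ) : ContDiff ℝ ∞ (brieskorn a).constraint := by
  have h : ∀ j, ContDiff ℝ ∞ fun z : ι → ℂ => z j := fun j =>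
    (ContinuousLinearMap.proj (R := ℝ) (φ := fun _ : ι => ℂ) j).contDiff
  exact (contDiff_sqNorm.sub contDiff_const).prodMk (ContDiff.sum fun j _ => (h j).pow (a j))

theorem fderiv_brieskorn_constraint (a : ι → ℕ) (z v : ι → ℂ) :
    fderiv ℝ (brieskorn a).constraint z v =
      (2 * ∑ j, ((z j).re * (v j).re + (z j).im * (v j).im),
        ∑ j, (a j : ℂ) * z j ^ (a j - 1) * v j) := by
  have h := ((hasFDerivAt_sqNorm z).sub_const 1).prodMk (hasFDerivAt_brieskornPoly a z)
  have h2 : fderiv ℝ (brieskorn a).constraint z = _ := h.fderiv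
  rw [h2]
  simp

theorem mem_brieskorn_carrier {a : ι → ℕ} {z : ι → ℂ} :
    z ∈ (brieskorn a).carrier ↔ sqNorm z = 1 ∧ ∑ j, z j ^ a j = 0 := by
  change (sqNorm z - 1, ∑ j, z j ^ a j) = (0 : ℝ × ℂ) ↔ _
  rw [Prod.mk_eq_zero, sub_eq_zero]

theorem mem_brieskorn_tangent {a : ι → ℕ} {z v : ι → ℂ} :
    v ∈ (brieskorn a).tangent z ↔ ∑ j, ((z j).re * (v j).re + (z j).im * (v j).im) = 0 ∧
      ∑ j, (a j : ℂ) * z j ^ (a j - 1) * v j = 0 := by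
  rw [FormOnLevelSet.tangent, LinearMap.mem_ker]
  change fderiv ℝ (brieskorn a).constraint z v = 0 ↔ _
  rw [fderiv_brieskorn_constraint, Prod.mk_eq_zero]
  simp

/-- The Reeb vector `(4 i / a_j) z_j` of a Brieskorn manifold. -/
def brieskornReeb (a : ι → ℕ) (z : ι → ℂ) : ι → ℂ := fun j => (4 / (a j : ℝ) : ℝ) * Complex.I * z j

variable {a : ι → ℕ}

/-- The factors 4 / a_j cancel the weights of α. The identity i_Z dα = -dF holds on all of ℂ^ι;
restricted to vectors tangent to the sphere it becomes the Reeb condition. -/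
theorem dform_brieskornReeb (ha : ∀ j, a j ≠ 0) (z w x : ι → ℂ) :
    (brieskorn a).dform x (brieskornReeb a z) w = - fderiv ℝ sqNorm z w := by
  rw [brieskorn_dform, fderiv_sqNorm, Finset.mul_sum, Finset.mul_sum, ← Finset.sum_neg_distrib]
  refine Finset.sum_congr rfl fun j _ => ?_
  have : (a j : ℝ) ≠ 0 := Nat.cast_ne_zero.2 (ha j)
  have hre : (brieskornReeb a z j).re = -(4 / (a j : ℝ)) * (z j).im := by
    rw [brieskornReeb, mul_assoc, Complex.re_ofReal_mul]
    simp
  have him : (brieskornReeb a z j).im = (4 / (a j : ℝ)) * (z j).re := by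
    rw [brieskornReeb, mul_assoc, Complex.im_ofReal_mul]
    simp
  rw [hre, him]
  field_simp
  ring

theorem form_brieskornReeb (ha : ∀ j, a j ≠ 0) (z : ι → ℂ) :
    (brieskorn a).form z (brieskornReeb a z) = sqNorm z := by
  rw [brieskorn_form, sqNorm, Finset.mul_sum]
  refine Finset.sum_congr rfl fun j _ => ?_
  have : (a j : ℝ) ≠ 0 := Nat.cast_ne_zero.2 (ha j)
  have hre : (brieskornReeb a z j).re = -(4 / (a j : ℝ)) * (z j).im := by
    rw [brieskornReeb, mul_assoc, Complex.re_ofReal_mul]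
    simp
  have him : (brieskornReeb a z j).im = (4 / (a j : ℝ)) * (z j).re := by
    rw [brieskornReeb, mul_assoc, Complex.im_ofReal_mul]
    simp
  rw [hre, him, Complex.normSq_apply]
  field_simp
  ring

/-- Euler's identity: the flow of the Reeb field multiplies every term z_j^{a_j} by exp(4it). -/
theorem sum_mul_brieskornReeb (ha : ∀ j, a j ≠ 0) (z : ι → ℂ) :
    ∑ j, (a j : ℂ) * z j ^ (a j - 1) * brieskornReeb a z j =
      4 * Complex.I * ∑ j, z j ^ a j := by
  rw [Finset.mul_sum]
  refine Finset.sum_congr rfl fun j _ => ?_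
  have : (a j : ℂ) ≠ 0 := Nat.cast_ne_zero.2 (ha j)
  have hp : z j ^ (a j - 1) * z j = z j ^ a j := by
    rw [← pow_succ, Nat.sub_add_cancel (Nat.one_le_iff_ne_zero.2 (ha j))]
  rw [← hp, brieskornReeb]
  push_cast
  field_simp

theorem fderiv_sqNorm_brieskornReeb (z : ι → ℂ) :
    ∑ j, ((z j).re * (brieskornReeb a z j).re + (z j).im * (brieskornReeb a z j).im) = 0 := by
  refine Finset.sum_eq_zero fun j _ => ?_
  rw [brieskornReeb, mul_assoc, Complex.re_ofReal_mul, Complex.im_ofReal_mul]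
  simp
  ring

theorem brieskornReeb_mem_tangent (ha : ∀ j, a j ≠ 0) {z : ι → ℂ}
    (hz : z ∈ (brieskorn a).carrier) : brieskornReeb a z ∈ (brieskorn a).tangent z := by
  rw [mem_brieskorn_tangent]
  refine ⟨fderiv_sqNorm_brieskornReeb z, ?_⟩
  rw [sum_mul_brieskornReeb ha, (mem_brieskorn_carrier.1 hz).2, mul_zero]

theorem isReebVector_brieskornReeb (ha : ∀ j, a j ≠ 0) {z : ι → ℂ}
    (hz : z ∈ (brieskorn a).carrier) : (brieskorn a).IsReebVector z (brieskornReeb a z) := by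
  refine ⟨brieskornReeb_mem_tangent ha hz, ?_, fun w hw => ?_⟩
  · rw [form_brieskornReeb ha, (mem_brieskorn_carrier.1 hz).1]
  · rw [dform_brieskornReeb ha, fderiv_sqNorm, (mem_brieskorn_tangent.1 hw).1]
    simp

theorem exists_ne_zero_of_mem_carrier {z : ι → ℂ} (hz : z ∈ (brieskorn a).carrier) :
    ∃ j, z j ≠ 0 := by
  by_contra! h
  have h1 := (mem_brieskorn_carrier.1 hz).1
  simp [sqNorm, h] at h1

/-- The conjugate gradient of the polynomial reaches every value of the complex component. The
weighted radial vector -iZ corrects the real component, since by Euler's identity it does not change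
the polynomial to first order on its zero set. -/
theorem regular_brieskorn (ha : ∀ j, a j ≠ 0) {z : ι → ℂ} (hz : z ∈ (brieskorn a).carrier) :
    Function.Surjective (fderiv ℝ (brieskorn a).constraint z) := by
  obtain ⟨k, hk⟩ := exists_ne_zero_of_mem_carrier hz
  have hpos : ∀ j, (0 : ℝ) < a j := fun j => Nat.cast_pos.2 (Nat.pos_of_ne_zero (ha j))
  set S : ℝ := ∑ j, (a j : ℝ) * Complex.normSq (z j ^ (a j - 1)) with hS
  have hSpos : 0 < S := by
    refine Finset.sum_pos' (fun j _ => mul_nonneg (hpos j).le (Complex.normSq_nonneg _))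
      ⟨k, Finset.mem_univ k, mul_pos (hpos k) (Complex.normSq_pos.2 (pow_ne_zero _ hk))⟩
  set R : ℝ := 2 * ∑ j, 4 / (a j : ℝ) * Complex.normSq (z j) with hR
  have hRpos : 0 < R := by
    refine mul_pos two_pos (Finset.sum_pos' (fun j _ => mul_nonneg
      (div_nonneg (by norm_num) (hpos j).le) (Complex.normSq_nonneg _))
      ⟨k, Finset.mem_univ k, mul_pos (div_pos (by norm_num) (hpos k)) (Complex.normSq_pos.2 hk)⟩)
  have h1 : ∀ c : ℂ, ∃ v, (fderiv ℝ (brieskorn a).constraint z v).2 = c := by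
    intro c
    refine ⟨fun j => c / S * conj (z j ^ (a j - 1)), ?_⟩
    rw [fderiv_brieskorn_constraint]
    have : ∀ j, (a j : ℂ) * z j ^ (a j - 1) * (c / S * conj (z j ^ (a j - 1))) =
        c / S * (((a j : ℝ) * Complex.normSq (z j ^ (a j - 1)) : ℝ) : ℂ) := by
      intro j
      push_cast
      rw [Complex.normSq_eq_conj_mul_self]
      ring
    simp only [this]
    rw [← Finset.mul_sum, ← Complex.ofReal_sum, ← hS]
    exact div_mul_cancel₀ c (Complex.ofReal_ne_zero.2 hSpos.ne')
  have h2 : ∀ s : ℝ, ∃ v, fderiv ℝ (brieskorn a).constraint z v = (s, 0) := by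
    intro s
    refine ⟨(s / R) • fun j => -Complex.I * brieskornReeb a z j, ?_⟩
    rw [map_smul, fderiv_brieskorn_constraint]
    have e1 : 2 * ∑ j, ((z j).re * (-Complex.I * brieskornReeb a z j).re +
        (z j).im * (-Complex.I * brieskornReeb a z j).im) = R := by
      rw [hR]
      congr 1
      refine Finset.sum_congr rfl fun j _ => ?_
      have : -Complex.I * brieskornReeb a z j = (4 / (a j : ℝ) : ℝ) * z j := by
        rw [brieskornReeb]
        linear_combination (-(4 / (a j : ℝ) : ℝ) * z j : ℂ) * Complex.I_mul_I
      rw [this, Complex.re_ofReal_mul, Complex.im_ofReal_mul, Complex.normSq_apply]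
      ring
    have e2 : ∑ j, (a j : ℂ) * z j ^ (a j - 1) * (-Complex.I * brieskornReeb a z j) = 0 := by
      have := sum_mul_brieskornReeb ha z
      rw [(mem_brieskorn_carrier.1 hz).2, mul_zero] at this
      rw [← mul_zero (-Complex.I), ← this, Finset.mul_sum]
      exact Finset.sum_congr rfl fun j _ => by ring
    rw [e1, e2]
    ext
    · simp [hRpos.ne']
    · simp
  rintro ⟨s, c⟩
  obtain ⟨v, hv⟩ := h1 c
  obtain ⟨w, hw⟩ := h2 (s - (fderiv ℝ (brieskorn a).constraint z v).1)
  refine ⟨v + w, ?_⟩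
  rw [map_add, hw]
  ext
  · simp
  · simpa using hv

theorem finrank_brieskorn_tangent (ha : ∀ j, a j ≠ 0) {z : ι → ℂ}
    (hz : z ∈ (brieskorn a).carrier) :
    finrank ℝ ((brieskorn a).tangent z) + 3 = 2 * Fintype.card ι := by
  have h := LinearMap.finrank_range_add_finrank_ker
    (fderiv ℝ (brieskorn a).constraint z : (ι → ℂ) →ₗ[ℝ] ℝ × ℂ)
  rw [LinearMap.range_eq_top.2 (regular_brieskorn ha hz), finrank_top] at h
  have e1 : finrank ℝ (ℝ × ℂ) = 3 := by
    rw [Module.finrank_prod, finrank_self, Complex.finrank_real_complex]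
  have e2 : finrank ℝ (ι → ℂ) = 2 * Fintype.card ι := by
    rw [Module.finrank_pi_fintype]
    simp [Complex.finrank_real_complex, mul_comm]
  rw [e1, e2] at h
  rw [← h, add_comm]
  rfl

/-- The Lutz–Meckert theorem: the form `α` is a contact form on the Brieskorn manifold. -/
theorem nondegenerate_brieskorn (ha : ∀ j, a j ≠ 0) {z : ι → ℂ} (hz : z ∈ (brieskorn a).carrier)
    {v : ι → ℂ} (hv : v ∈ (brieskorn a).tangent z) (hv0 : (brieskorn a).form z v = 0)
    (hvw : ∀ w ∈ (brieskorn a).tangent z, (brieskorn a).form z w = 0 →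
      (brieskorn a).dform z v w = 0) : v = 0 := by
  have hpos : ∀ j, (0 : ℝ) < a j := fun j => Nat.cast_pos.2 (Nat.pos_of_ne_zero (ha j))
  let l : (ι → ℂ) →ₗ[ℝ] ℝ :=
    { toFun := fun w => (brieskorn a).dform z v w
      map_add' := by intro a b; simp [FormOnLevelSet.dform]; ring
      map_smul' := by intro a b; simp [FormOnLevelSet.dform]; ring }
  have hZ := brieskornReeb_mem_tangent ha hz
  have hZ1 : (brieskorn a).form z (brieskornReeb a z) = 1 := by
    rw [form_brieskornReeb ha, (mem_brieskorn_carrier.1 hz).1]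
  have hskew : ∀ u w, (brieskorn a).dform z u w = - (brieskorn a).dform z w u := by
    intro u w
    simp [FormOnLevelSet.dform]
  have hvZ : (brieskorn a).dform z v (brieskornReeb a z) = 0 := by
    rw [hskew, dform_brieskornReeb ha, fderiv_sqNorm, (mem_brieskorn_tangent.1 hv).1]
    simp
  -- Since dα(v, Z) = 0, dα(v, ·) vanishes on the whole tangent space, not only on its horizontal
  -- part. It is therefore a combination of the differentials of the constraint, with multipliers
  -- `lam` and `μ`.
  obtain ⟨f, hf⟩ := exists_eq_comp_of_forall_ker
    (fderiv ℝ (brieskorn a).constraint z : (ι → ℂ) →ₗ[ℝ] ℝ × ℂ) l (by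
      intro w hw
      have hw' : w ∈ (brieskorn a).tangent z := hw
      have h := hvw (w - (brieskorn a).form z w • brieskornReeb a z)
        (Submodule.sub_mem _ hw' (Submodule.smul_mem _ _ hZ)) (by simp [hZ1])
      change l (w - (brieskorn a).form z w • brieskornReeb a z) = 0 at h
      rw [map_sub, map_smul, show l (brieskornReeb a z) = 0 from hvZ, smul_zero, sub_zero] at h
      exact h)
  obtain ⟨lam, μ, hlm⟩ := exists_real_complex_functional f
  have key : ∀ w, (brieskorn a).dform z v w = lam * fderiv ℝ sqNorm z w +
      (μ * ∑ j, (a j : ℂ) * z j ^ (a j - 1) * w j).re := by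
    intro w
    rw [show (brieskorn a).dform z v w = l w from rfl, hf]
    change f (fderiv ℝ (brieskorn a).constraint z w) = _
    rw [fderiv_brieskorn_constraint, hlm, fderiv_sqNorm]
  -- As i_Z dα = -dF, adding `lam • Z` cancels the dF term and leaves only the complex multiplier.
  set y : ι → ℂ := v + lam • brieskornReeb a z with hy
  have hyT : y ∈ (brieskorn a).tangent z :=
    Submodule.add_mem _ hv (Submodule.smul_mem _ _ hZ)
  have key2 : ∀ w, (brieskorn a).dform z y w =
      (μ * ∑ j, (a j : ℂ) * z j ^ (a j - 1) * w j).re := by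
    intro w
    have h1 := key w
    have h2 := dform_brieskornReeb ha z w z
    simp only [hy, FormOnLevelSet.dform, map_add, map_smul, _root_.add_apply, _root_.smul_apply,
      smul_eq_mul] at *
    linear_combination h1 + lam * h2
  have hy0 : y = 0 := by
    -- The differential of the polynomial is complex linear and kills `y`, hence also `i y`. On the
    -- other side dα(y, iy) = (1/2) ∑ a_j |y_j|² is positive definite.
    have h1 := key2 (fun j => Complex.I * y j)
    have h2 : ∑ j, (a j : ℂ) * z j ^ (a j - 1) * (Complex.I * y j) = 0 := by
      rw [← mul_zero Complex.I, ← (mem_brieskorn_tangent.1 hyT).2, Finset.mul_sum]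
      exact Finset.sum_congr rfl fun j _ => by ring
    rw [h2, brieskorn_dform] at h1
    have h3 : ∑ j, (a j : ℝ) * Complex.normSq (y j) = 0 := by
      simp only [mul_zero, Complex.zero_re, mul_eq_zero] at h1
      rcases h1 with h1 | h1
      · norm_num at h1
      · rw [← h1]
        refine Finset.sum_congr rfl fun j _ => ?_
        rw [Complex.normSq_apply]
        simp
    rw [Finset.sum_eq_zero_iff_of_nonneg fun j _ =>
      mul_nonneg (hpos j).le (Complex.normSq_nonneg _)] at h3
    ext1 j
    have h4 := h3 j (Finset.mem_univ j)
    rw [mul_eq_zero, Complex.normSq_eq_zero] at h4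
    exact h4.resolve_left (hpos j).ne'
  -- Now v = -`lam` Z, and α(v) = 0 while α(Z) = 1.
  have hlam : lam = 0 := by
    have h := congrArg ((brieskorn a).form z) hy0
    rwa [hy, map_add, map_smul, hv0, hZ1, map_zero, zero_add, smul_eq_mul, mul_one] at h
  rwa [hy, hlam, zero_smul, add_zero] at hy0

theorem isContact_brieskorn (ha : ∀ j, a j ≠ 0) {N : ℕ} (hN : Fintype.card ι = N + 2) :
    (brieskorn a).IsContact N where
  smooth_constraint := contDiff_brieskorn_constraint a
  smooth_form := (brieskornFormL a).contDiff
  regular _ hz := regular_brieskorn ha hz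
  dimension z hz := by
    have h := finrank_brieskorn_tangent ha hz
    omega
  form_ne_zero z hz := ⟨brieskornReeb a z, brieskornReeb_mem_tangent ha hz, by
    rw [form_brieskornReeb ha, (mem_brieskorn_carrier.1 hz).1]
    exact one_ne_zero⟩
  nondegenerate _ hz _ hv hv0 hvw := nondegenerate_brieskorn ha hz hv hv0 hvw

end Brieskorn

/-! ### The coordinates as two single ones and m pairs -/

section Coordinates

open ComplexConjugate

variable {m : ℕ}

/-- The index `2 (j + 1)` of the first coordinate of the `j`-th pair. -/
def fstIdx (j : Fin m) : Fin (2 * m + 2) := ⟨2 * (j + 1), by omega⟩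

/-- The index `2 (j + 1) + 1` of the second coordinate of the `j`-th pair. -/
def sndIdx (j : Fin m) : Fin (2 * m + 2) := ⟨2 * (j + 1) + 1, by omega⟩

/-- The vector with coordinates `x`, `y`, `a 0`, `b 0`, `a 1`, `b 1`, …. -/
def ofPairs {α : Type*} (x y : α) (a b : Fin m → α) (k : Fin (2 * m + 2)) : α :=
  if k.val = 0 then x else if k.val = 1 then y else
    if k.val % 2 = 0 then (if h : k.val / 2 - 1 < m then a ⟨k.val / 2 - 1, h⟩ else x) else
      (if h : k.val / 2 - 1 < m then b ⟨k.val / 2 - 1, h⟩ else x)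

variable {α : Type*} (x y : α) (a b : Fin m → α)

@[simp] theorem ofPairs_zero : ofPairs x y a b 0 = x := by simp [ofPairs]

@[simp] theorem ofPairs_one : ofPairs x y a b 1 = y := by
  simp [ofPairs]

@[simp] theorem ofPairs_fstIdx (j : Fin m) : ofPairs x y a b (fstIdx j) = a j := by
  have h1 : 2 * ((j : ℕ) + 1) ≠ 1 := by omega
  simp [ofPairs, fstIdx, h1]

@[simp] theorem ofPairs_sndIdx (j : Fin m) : ofPairs x y a b (sndIdx j) = b j := by
  have h1 : (2 * ((j : ℕ) + 1) + 1) % 2 = 1 := by omega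
  have h2 : (2 * ((j : ℕ) + 1) + 1) / 2 = j + 1 := by omega
  simp [ofPairs, sndIdx, h1, h2]

theorem idx_cases (k : Fin (2 * m + 2)) :
    k = 0 ∨ k = 1 ∨ (∃ j : Fin m, k = fstIdx j) ∨ ∃ j : Fin m, k = sndIdx j := by
  by_cases h0 : k.val = 0
  · exact Or.inl (Fin.ext h0)
  by_cases h1 : k.val = 1
  · exact Or.inr (Or.inl (Fin.ext h1))
  have hk := k.2
  rcases Nat.mod_two_eq_zero_or_one k.val with h | h
  · exact Or.inr (Or.inr (Or.inl ⟨⟨k.val / 2 - 1, by omega⟩, Fin.ext (by simp [fstIdx]; omega)⟩))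
  · exact Or.inr (Or.inr (Or.inr ⟨⟨k.val / 2 - 1, by omega⟩, Fin.ext (by simp [sndIdx]; omega)⟩))

theorem forall_idx {C : Fin (2 * m + 2) → Prop} :
    (∀ k, C k) ↔ C 0 ∧ C 1 ∧ (∀ j : Fin m, C (fstIdx j)) ∧ ∀ j : Fin m, C (sndIdx j) := by
  refine ⟨fun h => ⟨h _, h _, fun _ => h _, fun _ => h _⟩, fun ⟨h0, h1, h2, h3⟩ k => ?_⟩
  rcases idx_cases k with rfl | rfl | ⟨j, rfl⟩ | ⟨j, rfl⟩
  exacts [h0, h1, h2 j, h3 j]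

theorem ext_idx {z w : Fin (2 * m + 2) → α} (h0 : z 0 = w 0) (h1 : z 1 = w 1)
    (h2 : ∀ j : Fin m, z (fstIdx j) = w (fstIdx j))
    (h3 : ∀ j : Fin m, z (sndIdx j) = w (sndIdx j)) : z = w :=
  funext (forall_idx.2 ⟨h0, h1, h2, h3⟩)

/-- Induction on m: two further coordinates at the end form exactly one further pair. -/
theorem sum_idx {M : Type*} [AddCommMonoid M] (f : Fin (2 * m + 2) → M) :
    ∑ k, f k = f 0 + f 1 + ∑ j : Fin m, (f (fstIdx j) + f (sndIdx j)) := by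
  induction m with
  | zero =>
    rw [Fin.sum_univ_two]
    simp
  | succ m ih =>
    have h := ih (fun k => f (Fin.castLE (by omega) k))
    change ∑ k : Fin (2 * m + 2 + 1 + 1), f k = _
    rw [Fin.sum_univ_castSucc, Fin.sum_univ_castSucc, Fin.sum_univ_castSucc (n := m)]
    have e : ∑ i : Fin (2 * m + 2), f (Fin.castSucc (Fin.castSucc i)) =
      ∑ k : Fin (2 * m + 2), f (Fin.castLE (by omega) k) := rfl
    rw [e, h]
    simp only [add_assoc]
    rfl

theorem fstIdx_ne_zero (j : Fin m) : fstIdx j ≠ 0 := by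
  intro h
  have := congrArg Fin.val h
  simp [fstIdx] at this

theorem sndIdx_ne_zero (j : Fin m) : sndIdx j ≠ 0 := by
  intro h
  have := congrArg Fin.val h
  simp [sndIdx] at this

end Coordinates

/-! ### The linear action of ℝ^(m+1) and its invariants -/

section Action

open ComplexConjugate

variable {m : ℕ}

/-- The exponents `p, 2, …, 2`. -/
def ustilovskyExp (m p : ℕ) (j : Fin (2 * m + 2)) : ℕ := if j = 0 then p else 2

theorem ustilovsky_eq (m p : ℕ) : ustilovsky m p = brieskorn (ustilovskyExp m p) := rfl

@[simp] theorem ustilovskyExp_zero (p : ℕ) : ustilovskyExp m p 0 = p := if_pos rfl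

@[simp] theorem ustilovskyExp_one (p : ℕ) : ustilovskyExp m p 1 = 2 :=
  if_neg (by simp)

@[simp] theorem ustilovskyExp_fstIdx (p : ℕ) (j : Fin m) : ustilovskyExp m p (fstIdx j) = 2 :=
  if_neg (fstIdx_ne_zero j)

@[simp] theorem ustilovskyExp_sndIdx (p : ℕ) (j : Fin m) : ustilovskyExp m p (sndIdx j) = 2 :=
  if_neg (sndIdx_ne_zero j)

theorem ustilovskyExp_ne_zero {p : ℕ} (hp : p ≠ 0) (k : Fin (2 * m + 2)) :
    ustilovskyExp m p k ≠ 0 := by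
  unfold ustilovskyExp
  split_ifs
  · exact hp
  · exact two_ne_zero

/-- The quadratic form `z_{2j}² + z_{2j+1}²` of the `j`-th pair. -/
def pairSq (j : Fin m) (z : Fin (2 * m + 2) → ℂ) : ℂ := z (fstIdx j) ^ 2 + z (sndIdx j) ^ 2

/-- The squared norm of the `j`-th pair. -/
def pairNormSq (j : Fin m) (z : Fin (2 * m + 2) → ℂ) : ℝ :=
  Complex.normSq (z (fstIdx j)) + Complex.normSq (z (sndIdx j))

/-- In this form a common phase of the two coordinates visibly cancels. -/
theorem ustilovskyG_eq (j : Fin m) (z : Fin (2 * m + 2) → ℂ) :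
    ustilovskyG j z = 2 * (z (fstIdx j) * conj (z (sndIdx j))).im := by
  change 2 * ((z (fstIdx j)).im * (z (sndIdx j)).re - (z (sndIdx j)).im * (z (fstIdx j)).re) = _
  rw [Complex.mul_im, Complex.conj_re, Complex.conj_im]
  ring

theorem sum_pow_ustilovskyExp (p : ℕ) (z : Fin (2 * m + 2) → ℂ) :
    ∑ k, z k ^ ustilovskyExp m p k = z 0 ^ p + z 1 ^ 2 + ∑ j, pairSq j z := by
  rw [sum_idx]
  simp [pairSq]

theorem sqNorm_eq (z : Fin (2 * m + 2) → ℂ) :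
    sqNorm z = Complex.normSq (z 0) + Complex.normSq (z 1) + ∑ j, pairNormSq j z := by
  rw [sqNorm, sum_idx]
  rfl

theorem mem_ustilovsky_carrier {p : ℕ} {z : Fin (2 * m + 2) → ℂ} :
    z ∈ (ustilovsky m p).carrier ↔
      sqNorm z = 1 ∧ z 0 ^ p + z 1 ^ 2 + ∑ j, pairSq j z = 0 := by
  rw [ustilovsky_eq, mem_brieskorn_carrier, sum_pow_ustilovskyExp]

/-- The number `exp (i x)` of modulus one. -/
def unitExp (x : ℝ) : ℂ := Complex.exp (x * Complex.I)

@[simp] theorem unitExp_zero : unitExp 0 = 1 := by simp [unitExp]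

theorem unitExp_add (x y : ℝ) : unitExp (x + y) = unitExp x * unitExp y := by
  rw [unitExp, unitExp, unitExp, ← Complex.exp_add]
  push_cast
  ring_nf

@[simp] theorem normSq_unitExp (x : ℝ) : Complex.normSq (unitExp x) = 1 := by
  rw [Complex.normSq_eq_norm_sq, unitExp, Complex.norm_exp_ofReal_mul_I, one_pow]

theorem unitExp_mul_conj (x : ℝ) : unitExp x * conj (unitExp x) = 1 := by
  rw [Complex.mul_conj, normSq_unitExp, Complex.ofReal_one]

theorem unitExp_pow (x : ℝ) (n : ℕ) : unitExp x ^ n = unitExp (n * x) := by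
  rw [unitExp, unitExp, ← Complex.exp_nat_mul]
  push_cast
  ring_nf

theorem unitExp_int_mul_two_pi (n : ℤ) : unitExp (n * (2 * Real.pi)) = 1 := by
  rw [unitExp, Complex.exp_eq_one_iff]
  exact ⟨n, by push_cast; ring⟩

/-- The action of `ℝ^{m+1}` on `ℂ^{2m+2}` by the Reeb flow and by the rotations of the pairs,
as a map. -/
def torusActionFun (m p : ℕ) (t : Fin (m + 1) → ℝ) (z : Fin (2 * m + 2) → ℂ) : Fin (2 * m + 2) → ℂ :=
  -- The speeds 4 / p and 2 = 4 / 2 are the Reeb weights 4 / a_k. The angle 2 t_{j+1} of the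
  -- rotations is the one for which their generators are the contact fields of the g_j.
  ofPairs (unitExp (4 / p * t 0) * z 0) (unitExp (2 * t 0) * z 1)
    (fun j => unitExp (2 * t 0) * ((Real.cos (2 * t j.succ) : ℂ) * z (fstIdx j) -
      (Real.sin (2 * t j.succ) : ℂ) * z (sndIdx j)))
    (fun j => unitExp (2 * t 0) * ((Real.sin (2 * t j.succ) : ℂ) * z (fstIdx j) +
      (Real.cos (2 * t j.succ) : ℂ) * z (sndIdx j)))

/-- The action of `ℝ^{m+1}` on `ℂ^{2m+2}` by the Reeb flow and by the rotations of the pairs. -/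
def torusAction (m p : ℕ) (t : Fin (m + 1) → ℝ) :
    (Fin (2 * m + 2) → ℂ) →L[ℝ] (Fin (2 * m + 2) → ℂ) :=
  LinearMap.toContinuousLinearMap
    { toFun := torusActionFun m p t
      map_add' := by
        intro z w
        apply ext_idx <;> intros <;> simp only [torusActionFun, ofPairs_zero, ofPairs_one,
          ofPairs_fstIdx, ofPairs_sndIdx, Pi.add_apply] <;> ring
      map_smul' := by
        intro c z
        apply ext_idx <;> intros <;> simp only [torusActionFun, ofPairs_zero, ofPairs_one,
          ofPairs_fstIdx, ofPairs_sndIdx, Pi.smul_apply, RingHom.id_apply,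
          Complex.real_smul] <;> ring }

variable (p : ℕ) (t s : Fin (m + 1) → ℝ) (z : Fin (2 * m + 2) → ℂ)

theorem torusAction_apply : torusAction m p t z = torusActionFun m p t z := rfl

theorem torusAction_apply_zero : torusAction m p t z 0 = unitExp (4 / p * t 0) * z 0 := by
  rw [torusAction_apply, torusActionFun, ofPairs_zero]

theorem torusAction_apply_one : torusAction m p t z 1 = unitExp (2 * t 0) * z 1 := by
  rw [torusAction_apply, torusActionFun, ofPairs_one]

theorem torusAction_apply_fst (j : Fin m) : torusAction m p t z (fstIdx j) = unitExp (2 * t 0) *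
    ((Real.cos (2 * t j.succ) : ℂ) * z (fstIdx j) -
      (Real.sin (2 * t j.succ) : ℂ) * z (sndIdx j)) := by
  rw [torusAction_apply, torusActionFun, ofPairs_fstIdx]

theorem torusAction_apply_snd (j : Fin m) : torusAction m p t z (sndIdx j) = unitExp (2 * t 0) *
    ((Real.sin (2 * t j.succ) : ℂ) * z (fstIdx j) +
      (Real.cos (2 * t j.succ) : ℂ) * z (sndIdx j)) := by
  rw [torusAction_apply, torusActionFun, ofPairs_sndIdx]

theorem torusAction_zero : torusAction m p 0 = ContinuousLinearMap.id ℝ _ := by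
  ext1 z
  apply ext_idx <;> intros <;> simp [torusAction_apply_zero, torusAction_apply_one,
    torusAction_apply_fst, torusAction_apply_snd]

theorem torusAction_add :
    torusAction m p (s + t) = (torusAction m p s).comp (torusAction m p t) := by
  ext1 z
  apply ext_idx <;> intros <;> simp only [ContinuousLinearMap.comp_apply, torusAction_apply_zero,
    torusAction_apply_one, torusAction_apply_fst, torusAction_apply_snd, Pi.add_apply, mul_add,
    unitExp_add, Real.cos_add, Real.sin_add] <;> push_cast <;> ring

theorem cos_sq_add_sin_sq_complex (x : ℝ) :
    (Real.cos x : ℂ) ^ 2 + (Real.sin x : ℂ) ^ 2 = 1 := by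
  rw [← Complex.ofReal_pow, ← Complex.ofReal_pow, ← Complex.ofReal_add, Real.cos_sq_add_sin_sq,
    Complex.ofReal_one]

/-- A real rotation preserves the complex quadratic form, so only the square of the Reeb phase
remains. -/
theorem pairSq_torusAction (j : Fin m) :
    pairSq j (torusAction m p t z) = unitExp (4 * t 0) * pairSq j z := by
  have h : unitExp (4 * t 0) = unitExp (2 * t 0) ^ 2 := by
    rw [unitExp_pow]
    push_cast
    ring_nf
  rw [pairSq, pairSq, torusAction_apply_fst, torusAction_apply_snd, h]
  linear_combination (unitExp (2 * t 0) ^ 2 * (z (fstIdx j) ^ 2 + z (sndIdx j) ^ 2)) *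
    cos_sq_add_sin_sq_complex (2 * t j.succ)

theorem pairNormSq_torusAction (j : Fin m) :
    pairNormSq j (torusAction m p t z) = pairNormSq j z := by
  rw [pairNormSq, pairNormSq, torusAction_apply_fst, torusAction_apply_snd, map_mul, map_mul,
    normSq_unitExp, one_mul, one_mul]
  simp only [Complex.normSq_apply, Complex.add_re, Complex.add_im, Complex.sub_re, Complex.sub_im,
    Complex.re_ofReal_mul, Complex.im_ofReal_mul]
  linear_combination ((z (fstIdx j)).re ^ 2 + (z (fstIdx j)).im ^ 2 + (z (sndIdx j)).re ^ 2 +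
    (z (sndIdx j)).im ^ 2) * Real.cos_sq_add_sin_sq (2 * t j.succ)

theorem normSq_torusAction_zero :
    Complex.normSq (torusAction m p t z 0) = Complex.normSq (z 0) := by
  rw [torusAction_apply_zero, map_mul, normSq_unitExp, one_mul]

theorem normSq_torusAction_one :
    Complex.normSq (torusAction m p t z 1) = Complex.normSq (z 1) := by
  rw [torusAction_apply_one, map_mul, normSq_unitExp, one_mul]

theorem ustilovskyG_torusAction (j : Fin m) :
    ustilovskyG j (torusAction m p t z) = ustilovskyG j z := by
  rw [ustilovskyG_eq, ustilovskyG_eq, torusAction_apply_fst, torusAction_apply_snd, map_mul,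
    mul_mul_mul_comm, unitExp_mul_conj, one_mul]
  simp only [Complex.mul_im, Complex.conj_re, Complex.conj_im, Complex.add_re, Complex.add_im,
    Complex.sub_re, Complex.sub_im, Complex.mul_re, Complex.ofReal_re, Complex.ofReal_im]
  linear_combination (2 * ((z (fstIdx j)).im * (z (sndIdx j)).re -
    (z (fstIdx j)).re * (z (sndIdx j)).im)) * Real.cos_sq_add_sin_sq (2 * t j.succ)

theorem sqNorm_torusAction : sqNorm (torusAction m p t z) = sqNorm z := by
  rw [sqNorm_eq, sqNorm_eq, normSq_torusAction_zero, normSq_torusAction_one]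
  simp only [pairNormSq_torusAction]

theorem sq_torusAction_one : torusAction m p t z 1 ^ 2 = unitExp (4 * t 0) * z 1 ^ 2 := by
  rw [torusAction_apply_one, mul_pow, unitExp_pow]
  congr 2
  push_cast
  ring

variable {p t s z}

/-- All terms of the polynomial acquire the same factor exp(4 i t_0). -/
theorem torusAction_mem_carrier (hp : p ≠ 0) (hz : z ∈ (ustilovsky m p).carrier) :
    torusAction m p t z ∈ (ustilovsky m p).carrier := by
  rw [mem_ustilovsky_carrier] at *
  refine ⟨by rw [sqNorm_torusAction, hz.1], ?_⟩
  have h : unitExp (4 / p * t 0) ^ p = unitExp (4 * t 0) := by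
    rw [unitExp_pow]
    congr 1
    have : (p : ℝ) ≠ 0 := Nat.cast_ne_zero.2 hp
    field_simp
  rw [sq_torusAction_one, torusAction_apply_zero, mul_pow, h]
  simp only [pairSq_torusAction]
  rw [← Finset.mul_sum, ← mul_add, ← mul_add, hz.2, mul_zero]

/-- The periods of the Reeb flow and of the rotations of the pairs. -/
def torusPeriod (m p : ℕ) (i : Fin (m + 1)) : ℝ := if i = 0 then p * Real.pi else Real.pi

theorem torusPeriod_ne_zero (hp : p ≠ 0) (i : Fin (m + 1)) : torusPeriod m p i ≠ 0 := by
  have : (p : ℝ) ≠ 0 := Nat.cast_ne_zero.2 hp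
  unfold torusPeriod
  split_ifs
  · exact mul_ne_zero this Real.pi_ne_zero
  · exact Real.pi_ne_zero

/-- At time pπ the Reeb angles are 4π and 2pπ, and at time π a rotation has angle 2π. Minimality of
the periods plays no role: further stabilising elements are absorbed into the lattice. -/
theorem torusAction_period (hp : p ≠ 0) (i : Fin (m + 1)) (z : Fin (2 * m + 2) → ℂ) :
    torusAction m p (Pi.single i (torusPeriod m p i)) z = z := by
  have hp' : (p : ℝ) ≠ 0 := Nat.cast_ne_zero.2 hp
  refine Fin.cases ?_ (fun i => ?_) i
  · have h1 : unitExp (4 / p * (p * Real.pi)) = 1 := by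
      rw [← unitExp_int_mul_two_pi 2]
      congr 1
      push_cast
      field_simp
      ring
    have h2 : unitExp (2 * (p * Real.pi)) = 1 := by
      rw [← unitExp_int_mul_two_pi p]
      congr 1
      push_cast
      ring
    apply ext_idx <;> intros <;> simp [torusAction_apply_zero, torusAction_apply_one,
      torusAction_apply_fst, torusAction_apply_snd, torusPeriod, h1, h2]
  · have h : ∀ j : Fin m, Real.cos (2 * (Pi.single i.succ Real.pi : Fin (m + 1) → ℝ) j.succ) = 1 ∧
        Real.sin (2 * (Pi.single i.succ Real.pi : Fin (m + 1) → ℝ) j.succ) = 0 := by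
      intro j
      by_cases hj : j = i
      · subst hj
        simp
      · have : j.succ ≠ i.succ := fun h => hj (Fin.succ_injective _ h)
        simp [Pi.single_eq_of_ne this]
    apply ext_idx <;> intros <;> simp [torusAction_apply_zero, torusAction_apply_one,
      torusAction_apply_fst, torusAction_apply_snd, torusPeriod, h,
      -Complex.ofReal_cos, -Complex.ofReal_sin]

end Action

/-! ### Uniqueness of contact fields and antisymmetry of the bracket -/

namespace FormOnLevelSet

variable {E V : Type*} [NormedAddCommGroup E] [NormedSpace ℝ E]
  [NormedAddCommGroup V] [NormedSpace ℝ V] {M : FormOnLevelSet E V}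

theorem IsContact.reeb_eq [FiniteDimensional ℝ E] {N : ℕ} (hM : M.IsContact N) {x v : E} (hx : x ∈ M.carrier)
    (hv : M.IsReebVector x v) : M.reeb x = v :=
  reebVector_unique hM hx (reeb_spec hM hx) hv

theorem IsContact.contactField_eq [FiniteDimensional ℝ E] {N : ℕ} (hM : M.IsContact N) {f : E → ℝ} {x v : E}
    (hx : x ∈ M.carrier) (hv : M.IsContactVector f x v) : M.contactField f x = v :=
  contactVector_unique hM hx (contactField_spec hM f hx) hv

/-- `Y_f(g) = - Y_g(f)` for functions `f`, `g` which are invariant under the Reeb flow. -/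
theorem IsContact.fderiv_contactField_comm [FiniteDimensional ℝ E] {N : ℕ} (hM : M.IsContact N) {f g : E → ℝ} {x : E}
    (hx : x ∈ M.carrier) (hf : fderiv ℝ f x (M.reeb x) = 0) (hg : fderiv ℝ g x (M.reeb x) = 0) :
    fderiv ℝ g x (M.contactField f x) = - fderiv ℝ f x (M.contactField g x) := by
  obtain ⟨hf1, -, hf3⟩ := contactField_spec hM f hx
  obtain ⟨hg1, -, hg3⟩ := contactField_spec hM g hx
  -- Each side is read off from dα(Y_f, Y_g), by the defining equation of Y_f at Y_g and that of Y_g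
  -- at Y_f.
  have h1 := hf3 _ hg1
  have h2 := hg3 _ hf1
  rw [hf] at h1
  rw [hg] at h2
  simp only [dform] at h1 h2
  linarith

theorem bracket_of_fderiv_reeb_eq_zero {f : E → ℝ} (g : E → ℝ) {x : E}
    (hf : fderiv ℝ f x (M.reeb x) = 0) :
    M.bracket f g x = fderiv ℝ g x (M.contactField f x) := by
  rw [bracket, hf, mul_zero, sub_zero]

/-- The contact Hamiltonian vector field of the function `1` is the Reeb vector field. -/
theorem IsContact.bracket_one_eq [FiniteDimensional ℝ E] {N : ℕ} (hM : M.IsContact N) (g : E → ℝ) {x : E}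
    (hx : x ∈ M.carrier) : M.bracket (fun _ => 1) g x = fderiv ℝ g x (M.reeb x) := by
  obtain ⟨h1, h2, h3⟩ := reeb_spec hM hx
  have h : M.contactField (fun _ => 1) x = M.reeb x :=
    hM.contactField_eq hx ⟨h1, h2, fun w hw => by simp [h3 w hw]⟩
  rw [bracket, h]
  simp

end FormOnLevelSet

/-! ### Fundamental vector fields and contact Hamiltonian fields -/

section Fields

open ComplexConjugate

variable {m p : ℕ}

/-- The infinitesimal rotation of the `j`-th pair, which is the contact Hamiltonian vector field
of `g_j`. -/
def rotationField (j : Fin m) (z : Fin (2 * m + 2) → ℂ) : Fin (2 * m + 2) → ℂ :=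
  ofPairs 0 0 (fun i => if i = j then -2 * z (sndIdx j) else 0)
    (fun i => if i = j then 2 * z (fstIdx j) else 0)

/-- The Reeb vector field of `B_p`. -/
def ustilovskyReeb (m p : ℕ) (z : Fin (2 * m + 2) → ℂ) : Fin (2 * m + 2) → ℂ :=
  brieskornReeb (ustilovskyExp m p) z

/-- The fundamental vector field of the action of `ℝ^{m+1}`. -/
def torusGenerator (m p : ℕ) (v : Fin (m + 1) → ℝ) (z : Fin (2 * m + 2) → ℂ) :
    Fin (2 * m + 2) → ℂ :=
  v 0 • ustilovskyReeb m p z + ∑ j : Fin m, v j.succ • rotationField j z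

theorem hasDerivAt_unitExp (c : ℝ) :
    HasDerivAt (fun r : ℝ => unitExp (r * c)) (c * Complex.I) 0 := by
  have h : HasDerivAt (fun r : ℝ => ((r * c : ℝ) : ℂ) * Complex.I) (c * Complex.I) 0 := by
    have := (((hasDerivAt_id (0 : ℝ)).mul_const c).ofReal_comp).mul_const Complex.I
    simpa using this
  have h2 := h.cexp
  simpa [unitExp] using h2

theorem hasDerivAt_ofReal_cos (c : ℝ) :
    HasDerivAt (fun r : ℝ => (Real.cos (r * c) : ℂ)) 0 0 := by
  have h := ((hasDerivAt_id (0 : ℝ)).mul_const c).cos.ofReal_comp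
  simpa using h

theorem hasDerivAt_ofReal_sin (c : ℝ) :
    HasDerivAt (fun r : ℝ => (Real.sin (r * c) : ℂ)) c 0 := by
  have h := ((hasDerivAt_id (0 : ℝ)).mul_const c).sin.ofReal_comp
  simpa using h

theorem hasDerivAt_torusAction (v : Fin (m + 1) → ℝ) (z : Fin (2 * m + 2) → ℂ) :
    HasDerivAt (fun r : ℝ => torusAction m p (r • v) z) (torusGenerator m p v z) 0 := by
  rw [hasDerivAt_pi]
  have e2 : ∀ r c : ℝ, 2 * (r * c) = r * (2 * c) := fun r c => by ring
  have hE := hasDerivAt_unitExp (2 * v 0)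
  refine forall_idx.2 ⟨?_, ?_, fun j => ?_, fun j => ?_⟩
  · have e4 : ∀ r : ℝ, 4 / (p : ℝ) * (r * v 0) = r * (4 / p * v 0) := fun r => by ring
    simp only [torusAction_apply_zero, Pi.smul_apply, smul_eq_mul, e4]
    refine ((hasDerivAt_unitExp _).mul_const (z 0)).congr_deriv ?_
    simp [torusGenerator, ustilovskyReeb, brieskornReeb, rotationField]
    ring
  · simp only [torusAction_apply_one, Pi.smul_apply, smul_eq_mul, e2]
    refine (hE.mul_const (z 1)).congr_deriv ?_
    simp [torusGenerator, ustilovskyReeb, brieskornReeb, rotationField]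
    ring
  · simp only [torusAction_apply_fst, Pi.smul_apply, smul_eq_mul, e2]
    refine (hE.mul (((hasDerivAt_ofReal_cos _).mul_const _).sub
      ((hasDerivAt_ofReal_sin _).mul_const _))).congr_deriv ?_
    simp [torusGenerator, ustilovskyReeb, brieskornReeb, rotationField]
    ring
  · simp only [torusAction_apply_snd, Pi.smul_apply, smul_eq_mul, e2]
    refine (hE.mul (((hasDerivAt_ofReal_sin _).mul_const _).add
      ((hasDerivAt_ofReal_cos _).mul_const _))).congr_deriv ?_
    simp [torusGenerator, ustilovskyReeb, brieskornReeb, rotationField]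
    ring

theorem contDiff_unitExp : ContDiff ℝ ∞ unitExp := by
  unfold unitExp
  exact (Complex.ofRealCLM.contDiff.mul contDiff_const).cexp

theorem contDiff_torusAction (z : Fin (2 * m + 2) → ℂ) :
    ContDiff ℝ ∞ fun t => torusAction m p t z := by
  rw [contDiff_pi]
  have hc : ∀ i : Fin (m + 1), ContDiff ℝ ∞ fun t : Fin (m + 1) → ℝ => t i := fun i =>
    contDiff_apply ℝ ℝ i
  have hE : ContDiff ℝ ∞ fun t : Fin (m + 1) → ℝ => unitExp (2 * t 0) :=
    contDiff_unitExp.comp (contDiff_const.mul (hc 0))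
  have hcos : ∀ j : Fin m, ContDiff ℝ ∞
      fun t : Fin (m + 1) → ℝ => (Real.cos (2 * t j.succ) : ℂ) := fun j =>
    Complex.ofRealCLM.contDiff.comp (contDiff_const.mul (hc j.succ)).cos
  have hsin : ∀ j : Fin m, ContDiff ℝ ∞
      fun t : Fin (m + 1) → ℝ => (Real.sin (2 * t j.succ) : ℂ) := fun j =>
    Complex.ofRealCLM.contDiff.comp (contDiff_const.mul (hc j.succ)).sin
  refine forall_idx.2 ⟨?_, ?_, fun j => ?_, fun j => ?_⟩
  · simp only [torusAction_apply_zero]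
    exact (contDiff_unitExp.comp (contDiff_const.mul (hc 0))).mul contDiff_const
  · simp only [torusAction_apply_one]
    exact hE.mul contDiff_const
  · simp only [torusAction_apply_fst]
    exact hE.mul (((hcos j).mul contDiff_const).sub ((hsin j).mul contDiff_const))
  · simp only [torusAction_apply_snd]
    exact hE.mul (((hsin j).mul contDiff_const).add ((hcos j).mul contDiff_const))

theorem hasDerivAt_torusAction_add (z : Fin (2 * m + 2) → ℂ) (t v : Fin (m + 1) → ℝ) :
    HasDerivAt (fun r : ℝ => torusAction m p (t + r • v) z)
      (fderiv ℝ (fun t => torusAction m p t z) t v) 0 := by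
  have h1 : HasFDerivAt (fun t => torusAction m p t z)
      (fderiv ℝ (fun t => torusAction m p t z) t) (t + (0 : ℝ) • v) := by
    simpa using ((contDiff_torusAction z).differentiable (by simp) t).hasFDerivAt
  have h2 : HasDerivAt (fun r : ℝ => t + r • v) v 0 := by
    simpa using ((hasDerivAt_id (0 : ℝ)).smul_const v).const_add t
  exact h1.comp_hasDerivAt (0 : ℝ) h2

/-- Here the small step `r • v` is applied after `t`, which identifies the derivative with the
fundamental field at the moved point. In `fderiv_torusAction_eq_action` it is applied before `t`,
which writes the derivative as the image under an invertible map of its value at the origin. -/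
theorem fderiv_torusAction (z : Fin (2 * m + 2) → ℂ) (t v : Fin (m + 1) → ℝ) :
    fderiv ℝ (fun t => torusAction m p t z) t v = torusGenerator m p v (torusAction m p t z) := by
  refine (hasDerivAt_torusAction_add z t v).unique ((hasDerivAt_torusAction v
    (torusAction m p t z)).congr_of_eventuallyEq (Filter.Eventually.of_forall fun r => ?_))
  simp only
  rw [add_comm t, torusAction_add]
  rfl

theorem fderiv_torusAction_eq_action (z : Fin (2 * m + 2) → ℂ) (t v : Fin (m + 1) → ℝ) :
    fderiv ℝ (fun t => torusAction m p t z) t v = torusAction m p t (torusGenerator m p v z) := by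
  refine (hasDerivAt_torusAction_add z t v).unique
    (((torusAction m p t).hasFDerivAt.comp_hasDerivAt (0 : ℝ)
      (hasDerivAt_torusAction v z)).congr_of_eventuallyEq (Filter.Eventually.of_forall fun r => ?_))
  simp only [Function.comp_apply]
  rw [torusAction_add]
  rfl

/-- The derivative of an invariant function along the fundamental vector fields vanishes. -/
theorem fderiv_torusGenerator_eq_zero {f : (Fin (2 * m + 2) → ℂ) → ℝ}
    {z : Fin (2 * m + 2) → ℂ} (hf : DifferentiableAt ℝ f z)
    (hinv : ∀ t z, f (torusAction m p t z) = f z) (v : Fin (m + 1) → ℝ) :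
    fderiv ℝ f z (torusGenerator m p v z) = 0 := by
  have h := hasDerivAt_torusAction (p := p) v z
  have h0 : torusAction m p ((0 : ℝ) • v) z = z := by
    rw [zero_smul, torusAction_zero]
    rfl
  have h1 : HasFDerivAt f (fderiv ℝ f z) (torusAction m p ((0 : ℝ) • v) z) := by
    rw [h0]
    exact hf.hasFDerivAt
  have h2 := h1.comp_hasDerivAt (0 : ℝ) h
  refine h2.unique ((hasDerivAt_const (0 : ℝ) (f z)).congr_of_eventuallyEq
    (Filter.Eventually.of_forall fun r => ?_))
  simp [hinv]

theorem torusGenerator_single_zero (z : Fin (2 * m + 2) → ℂ) :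
    torusGenerator m p (Pi.single 0 1) z = ustilovskyReeb m p z := by
  simp [torusGenerator]

theorem torusGenerator_single_succ (j : Fin m) (z : Fin (2 * m + 2) → ℂ) :
    torusGenerator m p (Pi.single j.succ 1) z = rotationField j z := by
  rw [torusGenerator, Finset.sum_eq_single j]
  · simp
  · intro i _ hi
    rw [Pi.single_eq_of_ne fun h => hi (Fin.succ_injective _ h), zero_smul]
  · simp

theorem fderiv_ustilovskyReeb_eq_zero {f : (Fin (2 * m + 2) → ℂ) → ℝ}
    {z : Fin (2 * m + 2) → ℂ} (hf : DifferentiableAt ℝ f z)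
    (hinv : ∀ t z, f (torusAction m p t z) = f z) :
    fderiv ℝ f z (ustilovskyReeb m p z) = 0 := by
  rw [← torusGenerator_single_zero]
  exact fderiv_torusGenerator_eq_zero hf hinv _

theorem contDiff_re (k : Fin (2 * m + 2)) :
    ContDiff ℝ ∞ fun z : Fin (2 * m + 2) → ℂ => (z k).re :=
  (Complex.reCLM.comp
    (ContinuousLinearMap.proj (R := ℝ) (φ := fun _ : Fin (2 * m + 2) => ℂ) k)).contDiff

theorem contDiff_im (k : Fin (2 * m + 2)) :
    ContDiff ℝ ∞ fun z : Fin (2 * m + 2) → ℂ => (z k).im :=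
  (Complex.imCLM.comp
    (ContinuousLinearMap.proj (R := ℝ) (φ := fun _ : Fin (2 * m + 2) => ℂ) k)).contDiff

theorem contDiff_ustilovskyG (j : Fin m) : ContDiff ℝ ∞ (ustilovskyG j) :=
  contDiff_const.mul (((contDiff_im _).mul (contDiff_re _)).sub
    ((contDiff_im _).mul (contDiff_re _)))

theorem contDiff_ustilovskyH (ε : Fin m → ℝ) : ContDiff ℝ ∞ (ustilovskyH ε) :=
  contDiff_sqNorm.add (ContDiff.sum fun j _ => contDiff_const.mul (contDiff_ustilovskyG j))

theorem ustilovskyH_torusAction (ε : Fin m → ℝ) (t : Fin (m + 1) → ℝ)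
    (z : Fin (2 * m + 2) → ℂ) : ustilovskyH ε (torusAction m p t z) = ustilovskyH ε z := by
  simp only [ustilovskyH, sqNorm_torusAction, ustilovskyG_torusAction]

theorem hasFDerivAt_re (k : Fin (2 * m + 2)) (z : Fin (2 * m + 2) → ℂ) :
    HasFDerivAt (fun z : Fin (2 * m + 2) → ℂ => (z k).re) (Complex.reCLM.comp
      (ContinuousLinearMap.proj (R := ℝ) (φ := fun _ : Fin (2 * m + 2) => ℂ) k)) z :=
  (Complex.reCLM.comp
    (ContinuousLinearMap.proj (R := ℝ) (φ := fun _ : Fin (2 * m + 2) => ℂ) k)).hasFDerivAt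

theorem hasFDerivAt_im (k : Fin (2 * m + 2)) (z : Fin (2 * m + 2) → ℂ) :
    HasFDerivAt (fun z : Fin (2 * m + 2) → ℂ => (z k).im) (Complex.imCLM.comp
      (ContinuousLinearMap.proj (R := ℝ) (φ := fun _ : Fin (2 * m + 2) => ℂ) k)) z :=
  (Complex.imCLM.comp
    (ContinuousLinearMap.proj (R := ℝ) (φ := fun _ : Fin (2 * m + 2) => ℂ) k)).hasFDerivAt

theorem fderiv_ustilovskyG (j : Fin m) (z w : Fin (2 * m + 2) → ℂ) :
    fderiv ℝ (ustilovskyG j) z w =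
      2 * ((w (fstIdx j)).im * (z (sndIdx j)).re + (z (fstIdx j)).im * (w (sndIdx j)).re -
        (w (sndIdx j)).im * (z (fstIdx j)).re - (z (sndIdx j)).im * (w (fstIdx j)).re) := by
  have h : HasFDerivAt (ustilovskyG j) _ z :=
    ((((hasFDerivAt_im (fstIdx j) z).mul (hasFDerivAt_re (sndIdx j) z)).sub
      ((hasFDerivAt_im (sndIdx j) z).mul (hasFDerivAt_re (fstIdx j) z)))).const_mul 2
  rw [h.fderiv]
  simp
  ring

theorem fderiv_ustilovskyH (ε : Fin m → ℝ) (z w : Fin (2 * m + 2) → ℂ) :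
    fderiv ℝ (ustilovskyH ε) z w =
      fderiv ℝ sqNorm z w + ∑ j, ε j * fderiv ℝ (ustilovskyG j) z w := by
  have h : HasFDerivAt (ustilovskyH ε) _ z :=
    ((contDiff_sqNorm.differentiable (by simp) z).hasFDerivAt).add
      (HasFDerivAt.fun_sum fun j (_ : j ∈ Finset.univ) =>
        (((contDiff_ustilovskyG j).differentiable (by simp) z).hasFDerivAt).const_mul (ε j))
  rw [h.fderiv]
  simp

theorem isContact_ustilovsky (m : ℕ) (hp : p ≠ 0) : (ustilovsky m p).IsContact (2 * m) :=
  isContact_brieskorn (ustilovskyExp_ne_zero hp) (by simp)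

variable {z : Fin (2 * m + 2) → ℂ}

theorem reeb_ustilovsky (hp : p ≠ 0) (hz : z ∈ (ustilovsky m p).carrier) :
    (ustilovsky m p).reeb z = ustilovskyReeb m p z :=
  (isContact_ustilovsky m hp).reeb_eq hz
    (isReebVector_brieskornReeb (ustilovskyExp_ne_zero hp) hz)

/-- As for the Reeb field, this holds for all ambient vectors. Together with Z(g_j) = 0 it is the
defining equation of Y_{g_j}. -/
theorem dform_rotationField (j : Fin m) (z w x : Fin (2 * m + 2) → ℂ) :
    (ustilovsky m p).dform x (rotationField j z) w = - fderiv ℝ (ustilovskyG j) z w := by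
  rw [ustilovsky_eq, brieskorn_dform, sum_idx, fderiv_ustilovskyG, Finset.sum_eq_single j]
  · simp [rotationField]
    ring
  · intro i _ hi
    simp [rotationField, hi]
  · simp

theorem rotationField_mem_tangent (j : Fin m) (z : Fin (2 * m + 2) → ℂ) :
    rotationField j z ∈ (ustilovsky m p).tangent z := by
  rw [ustilovsky_eq, mem_brieskorn_tangent, sum_idx, sum_idx]
  constructor
  · rw [Finset.sum_eq_single j]
    · simp [rotationField]
      ring
    · intro i _ hi
      simp [rotationField, hi]
    · simp
  · rw [Finset.sum_eq_single j]
    · simp [rotationField]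
      ring
    · intro i _ hi
      simp [rotationField, hi]
    · simp

theorem form_rotationField (j : Fin m) (z : Fin (2 * m + 2) → ℂ) :
    (ustilovsky m p).form z (rotationField j z) = ustilovskyG j z := by
  rw [ustilovsky_eq, brieskorn_form, sum_idx, Finset.sum_eq_single j]
  · simp [rotationField, ustilovskyG_eq]
    ring
  · intro i _ hi
    simp [rotationField, hi]
  · simp

theorem fderiv_ustilovskyG_reeb (j : Fin m) (z : Fin (2 * m + 2) → ℂ) :
    fderiv ℝ (ustilovskyG j) z (ustilovskyReeb m p z) = 0 :=
  fderiv_ustilovskyReeb_eq_zero ((contDiff_ustilovskyG j).differentiable (by simp) z)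
    fun t z => ustilovskyG_torusAction p t z j

theorem contactField_ustilovskyG (hp : p ≠ 0) (hz : z ∈ (ustilovsky m p).carrier) (j : Fin m) :
    (ustilovsky m p).contactField (ustilovskyG j) z = rotationField j z := by
  refine (isContact_ustilovsky m hp).contactField_eq hz
    ⟨rotationField_mem_tangent j z, form_rotationField j z, fun w _ => ?_⟩
  rw [dform_rotationField, reeb_ustilovsky hp hz, fderiv_ustilovskyG_reeb]
  ring

theorem fderiv_sqNorm_of_mem_tangent {w : Fin (2 * m + 2) → ℂ}
    (hw : w ∈ (ustilovsky m p).tangent z) : fderiv ℝ sqNorm z w = 0 := by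
  rw [ustilovsky_eq, mem_brieskorn_tangent] at hw
  rw [fderiv_sqNorm, hw.1, mul_zero]

theorem ustilovskyReeb_mem_tangent (hp : p ≠ 0) (hz : z ∈ (ustilovsky m p).carrier) :
    ustilovskyReeb m p z ∈ (ustilovsky m p).tangent z :=
  brieskornReeb_mem_tangent (ustilovskyExp_ne_zero hp) hz

theorem form_ustilovskyReeb (hp : p ≠ 0) (hz : z ∈ (ustilovsky m p).carrier) :
    (ustilovsky m p).form z (ustilovskyReeb m p z) = 1 :=
  (isReebVector_brieskornReeb (ustilovskyExp_ne_zero hp) hz).2.1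

theorem torusGenerator_mem_tangent (hp : p ≠ 0) (hz : z ∈ (ustilovsky m p).carrier)
    (v : Fin (m + 1) → ℝ) : torusGenerator m p v z ∈ (ustilovsky m p).tangent z :=
  Submodule.add_mem _ (Submodule.smul_mem _ _ (ustilovskyReeb_mem_tangent hp hz))
    (Submodule.sum_mem _ fun j _ => Submodule.smul_mem _ _ (rotationField_mem_tangent j z))

/-- The Reeb part contributes only dF, which vanishes on tangent vectors. The formula yields both
the freeness of the action and the isotropy of its orbits. -/
theorem dform_torusGenerator (hp : p ≠ 0) {w : Fin (2 * m + 2) → ℂ}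
    (hw : w ∈ (ustilovsky m p).tangent z) (v : Fin (m + 1) → ℝ) :
    (ustilovsky m p).dform z (torusGenerator m p v z) w =
      - ∑ j, v j.succ * fderiv ℝ (ustilovskyG j) z w := by
  have h1 : (ustilovsky m p).dform z (ustilovskyReeb m p z) w = 0 := by
    rw [ustilovskyReeb, ustilovsky_eq, dform_brieskornReeb (ustilovskyExp_ne_zero hp),
      fderiv_sqNorm_of_mem_tangent hw, neg_zero]
  have h2 : (ustilovsky m p).dform z (torusGenerator m p v z) w =
      v 0 * (ustilovsky m p).dform z (ustilovskyReeb m p z) w +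
        ∑ j : Fin m, v j.succ * (ustilovsky m p).dform z (rotationField j z) w := by
    simp only [torusGenerator, FormOnLevelSet.dform, map_add, map_smul, map_sum, mul_sub,
      Finset.sum_sub_distrib, _root_.add_apply, _root_.smul_apply, _root_.sum_apply, smul_eq_mul]
    ring
  rw [h2, h1, mul_zero, zero_add, ← Finset.sum_neg_distrib]
  exact Finset.sum_congr rfl fun j _ => by rw [dform_rotationField, mul_neg]

/-- On B_p the function F is 1, so H restricts to 1 + ∑ ε_j g_j; the contact field depends linearly
on the function, and that of 1 is Z. -/
theorem contactField_ustilovskyH (hp : p ≠ 0) (hz : z ∈ (ustilovsky m p).carrier)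
    (ε : Fin m → ℝ) :
    (ustilovsky m p).contactField (ustilovskyH ε) z = torusGenerator m p (Fin.cons 1 ε) z := by
  refine (isContact_ustilovsky m hp).contactField_eq hz
    ⟨torusGenerator_mem_tangent hp hz _, ?_, fun w hw => ?_⟩
  · rw [torusGenerator, map_add, map_smul, map_sum, form_ustilovskyReeb hp hz, ustilovskyH,
      (mem_ustilovsky_carrier.1 hz).1]
    simp [form_rotationField]
  · rw [dform_torusGenerator hp hw, reeb_ustilovsky hp hz, fderiv_ustilovskyReeb_eq_zero
      ((contDiff_ustilovskyH ε).differentiable (by simp) z) (ustilovskyH_torusAction ε),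
      fderiv_ustilovskyH, fderiv_sqNorm_of_mem_tangent hw]
    simp

end Fields

/-! ### Independence of the integrals at generic points -/

section Integrals

open ComplexConjugate

variable {m p : ℕ}

/-- The imaginary part of `(z_{2j}² + z_{2j+1}²) z̄₁²`, which measures the angle between the two
squares. -/
def pairPhase (j : Fin m) (z : Fin (2 * m + 2) → ℂ) : ℝ := (pairSq j z * conj (z 1 ^ 2)).im

/-- Both squares are multiplied by exp(4 i t_0), which cancels against its conjugate. -/
theorem pairPhase_torusAction (j : Fin m) (t : Fin (m + 1) → ℝ) (z : Fin (2 * m + 2) → ℂ) :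
    pairPhase j (torusAction m p t z) = pairPhase j z := by
  rw [pairPhase, pairPhase, pairSq_torusAction, sq_torusAction_one, map_mul, mul_mul_mul_comm,
    unitExp_mul_conj, one_mul]

theorem hasFDerivAt_coord (k : Fin (2 * m + 2)) (z : Fin (2 * m + 2) → ℂ) :
    HasFDerivAt (fun z : Fin (2 * m + 2) → ℂ => z k)
      (ContinuousLinearMap.proj (R := ℝ) (φ := fun _ : Fin (2 * m + 2) => ℂ) k) z :=
  (ContinuousLinearMap.proj (R := ℝ) (φ := fun _ : Fin (2 * m + 2) => ℂ) k).hasFDerivAt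

theorem contDiff_coord (k : Fin (2 * m + 2)) :
    ContDiff ℝ ∞ fun z : Fin (2 * m + 2) → ℂ => z k :=
  (ContinuousLinearMap.proj (R := ℝ) (φ := fun _ : Fin (2 * m + 2) => ℂ) k).contDiff

theorem contDiff_normSq_coord (k : Fin (2 * m + 2)) :
    ContDiff ℝ ∞ fun z : Fin (2 * m + 2) → ℂ => Complex.normSq (z k) := by
  simp only [Complex.normSq_apply]
  exact ((contDiff_re k).mul (contDiff_re k)).add ((contDiff_im k).mul (contDiff_im k))

theorem fderiv_normSq_coord (k : Fin (2 * m + 2)) (z w : Fin (2 * m + 2) → ℂ) :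
    fderiv ℝ (fun z : Fin (2 * m + 2) → ℂ => Complex.normSq (z k)) z w =
      2 * ((z k).re * (w k).re + (z k).im * (w k).im) := by
  have h := ((hasFDerivAt_re k z).mul (hasFDerivAt_re k z)).add
    ((hasFDerivAt_im k z).mul (hasFDerivAt_im k z))
  have h2 : HasFDerivAt (fun z : Fin (2 * m + 2) → ℂ => Complex.normSq (z k)) _ z := h
  rw [h2.fderiv]
  simp
  ring

theorem contDiff_pairNormSq (j : Fin m) : ContDiff ℝ ∞ (pairNormSq j) :=
  (contDiff_normSq_coord _).add (contDiff_normSq_coord _)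

theorem fderiv_pairNormSq (j : Fin m) (z w : Fin (2 * m + 2) → ℂ) :
    fderiv ℝ (pairNormSq j) z w =
      2 * ((z (fstIdx j)).re * (w (fstIdx j)).re + (z (fstIdx j)).im * (w (fstIdx j)).im) +
      2 * ((z (sndIdx j)).re * (w (sndIdx j)).re + (z (sndIdx j)).im * (w (sndIdx j)).im) := by
  have h : HasFDerivAt (pairNormSq j) _ z :=
    ((contDiff_normSq_coord (fstIdx j)).differentiable (by simp) z).hasFDerivAt.add
      ((contDiff_normSq_coord (sndIdx j)).differentiable (by simp) z).hasFDerivAt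
  rw [h.fderiv, _root_.add_apply, fderiv_normSq_coord, fderiv_normSq_coord]

theorem contDiff_pairSq (j : Fin m) : ContDiff ℝ ∞ (pairSq j) :=
  ((contDiff_coord _).pow 2).add ((contDiff_coord _).pow 2)

theorem contDiff_pairPhase (j : Fin m) : ContDiff ℝ ∞ (pairPhase j) :=
  Complex.imCLM.contDiff.comp ((contDiff_pairSq j).mul
    ((Complex.conjCLE : ℂ →L[ℝ] ℂ).contDiff.comp ((contDiff_coord 1).pow 2)))

theorem fderiv_pairPhase (j : Fin m) (z w : Fin (2 * m + 2) → ℂ) :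
    fderiv ℝ (pairPhase j) z w =
      (2 * (z (fstIdx j) * w (fstIdx j) + z (sndIdx j) * w (sndIdx j)) * conj (z 1 ^ 2) +
        pairSq j z * conj (2 * z 1 * w 1)).im := by
  have h1 := ((hasFDerivAt_coord (fstIdx j) z).pow 2).add ((hasFDerivAt_coord (sndIdx j) z).pow 2)
  have h2 := (Complex.conjCLE : ℂ →L[ℝ] ℂ).hasFDerivAt.comp z ((hasFDerivAt_coord 1 z).pow 2)
  have h : HasFDerivAt (pairPhase j) _ z := Complex.imCLM.hasFDerivAt.comp z (h1.mul h2)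
  rw [h.fderiv]
  simp [pairSq]
  ring

theorem fderiv_constraint_ustilovsky (z w : Fin (2 * m + 2) → ℂ) :
    fderiv ℝ (ustilovsky m p).constraint z w = (fderiv ℝ sqNorm z w,
      p * z 0 ^ (p - 1) * w 0 + 2 * z 1 * w 1 +
        ∑ j, 2 * (z (fstIdx j) * w (fstIdx j) + z (sndIdx j) * w (sndIdx j))) := by
  rw [ustilovsky_eq, fderiv_brieskorn_constraint, fderiv_sqNorm, Prod.mk.injEq]
  refine ⟨rfl, ?_⟩
  rw [sum_idx]
  simp [mul_add, mul_assoc]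

theorem fderiv_sqNorm_eq (z w : Fin (2 * m + 2) → ℂ) :
    fderiv ℝ sqNorm z w = 2 * ((z 0).re * (w 0).re + (z 0).im * (w 0).im) +
      2 * ((z 1).re * (w 1).re + (z 1).im * (w 1).im) + ∑ j, fderiv ℝ (pairNormSq j) z w := by
  rw [fderiv_sqNorm, sum_idx, mul_add, mul_add, Finset.mul_sum]
  simp only [fderiv_pairNormSq, mul_add]

/-- The generic points of `B_p`, at which the integrals are independent. -/
def genericSet (m p : ℕ) : Set (Fin (2 * m + 2) → ℂ) :=
  -- The first pair has no phase among the integrals; the condition on it says that its square is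
  -- not real proportional to z_0^p, which eliminates the complex multiplier. For every other pair
  -- the condition says that turning the pair changes its phase integral to first order.
  {z | z 1 ≠ 0 ∧ ∀ j : Fin m, if (j : ℕ) = 0 then (conj (z 0 ^ p) * pairSq j z).im ≠ 0
    else (pairSq j z * conj (z 1 ^ 2)).re ≠ 0}

/-- The numbers `x` and `y` form a real basis of ℂ, so Im (μ ·) vanishes identically. -/
theorem eq_zero_of_im_mul_eq_zero {μ x y : ℂ} (hx : (μ * x).im = 0) (hy : (μ * y).im = 0)
    (hxy : (conj x * y).im ≠ 0) : μ = 0 := by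
  simp only [Complex.mul_im, Complex.conj_re, Complex.conj_im] at *
  apply Complex.ext
  · refine (mul_eq_zero.1 ?_).resolve_right hxy
    linear_combination x.re * hy - y.re * hx
  · refine (mul_eq_zero.1 ?_).resolve_right hxy
    linear_combination y.im * hx - x.im * hy

/-- The vector whose only nonzero coordinates are those of the `j`-th pair. -/
def pairVec (j : Fin m) (x y : ℂ) : Fin (2 * m + 2) → ℂ :=
  ofPairs 0 0 (fun i => if i = j then x else 0) (fun i => if i = j then y else 0)

/-- At generic points the differentials of the `g_j`, the `|z_{2j}|² + |z_{2j+1}|²`, `|z₁|²` and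
of the phases of all pairs but the first one are linearly independent modulo the differential of
the constraint. -/
theorem coeff_eq_zero_of_generic (hp : p ≠ 0) (hm : 0 < m) {z : Fin (2 * m + 2) → ℂ}
    (hz : z ∈ genericSet m p) {γ η τ : Fin m → ℝ} {σ l : ℝ} {μ : ℂ} (hτ : τ ⟨0, hm⟩ = 0)
    (h : ∀ w, ∑ j, (γ j * fderiv ℝ (ustilovskyG j) z w + η j * fderiv ℝ (pairNormSq j) z w +
        τ j * fderiv ℝ (pairPhase j) z w) +
        σ * fderiv ℝ (fun z : Fin (2 * m + 2) → ℂ => Complex.normSq (z 1)) z w =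
      l * (fderiv ℝ (ustilovsky m p).constraint z w).1 +
        (μ * (fderiv ℝ (ustilovsky m p).constraint z w).2).re) :
    γ = 0 ∧ η = 0 ∧ τ = 0 ∧ σ = 0 := by
  obtain ⟨hz1, hzj⟩ := hz
  have hgen := hzj ⟨0, hm⟩
  rw [if_pos rfl] at hgen
  have hz0 : z 0 ≠ 0 := by
    intro h0
    apply hgen
    rw [h0, zero_pow hp]
    simp
  have hpow : z 0 ^ (p - 1) * z 0 = z 0 ^ p := by
    rw [← pow_succ, Nat.sub_add_cancel (Nat.one_le_iff_ne_zero.2 hp)]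
  simp only [fderiv_constraint_ustilovsky, fderiv_normSq_coord, fderiv_sqNorm_eq] at h
  -- the values on vectors supported on the first two coordinates and on one pair
  have h01 : ∀ x y : ℂ, (∑ j, τ j * (pairSq j z * conj (2 * z 1 * y)).im) +
      σ * (2 * ((z 1).re * y.re + (z 1).im * y.im)) =
      l * (2 * ((z 0).re * x.re + (z 0).im * x.im) + 2 * ((z 1).re * y.re + (z 1).im * y.im)) +
        (μ * (p * z 0 ^ (p - 1) * x + 2 * z 1 * y)).re := by
    intro x y
    have h1 := h (ofPairs x y (fun _ => 0) (fun _ => 0))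
    simpa [fderiv_ustilovskyG, fderiv_pairNormSq, fderiv_pairPhase] using h1
  have hpair : ∀ j x y, γ j * fderiv ℝ (ustilovskyG j) z (pairVec j x y) +
      η j * fderiv ℝ (pairNormSq j) z (pairVec j x y) +
      τ j * (2 * (z (fstIdx j) * x + z (sndIdx j) * y) * conj (z 1 ^ 2)).im =
      l * fderiv ℝ (pairNormSq j) z (pairVec j x y) +
        (μ * (2 * (z (fstIdx j) * x + z (sndIdx j) * y))).re := by
    intro j x y
    have h1 := h (pairVec j x y)
    rw [Finset.sum_eq_single j, Finset.sum_eq_single j, Finset.sum_eq_single j] at h1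
    · simpa [pairVec, fderiv_pairPhase] using h1
    · intro i _ hi
      simp [pairVec, hi]
    · simp
    · intro i _ hi
      simp [pairVec, hi, fderiv_pairNormSq]
    · simp
    · intro i _ hi
      simp [pairVec, hi, fderiv_pairNormSq, fderiv_ustilovskyG, fderiv_pairPhase]
    · simp
  have hrot : ∀ j, τ j * (pairSq j z * conj (z 1 ^ 2)).re = -(μ * pairSq j z).im := by
    intro j
    -- Write a, b = z_{2j} ± i z_{2j+1}. This vector turns a and fixes b. It keeps |a|² and |b|²,
    -- which are the squared norm of the pair plus and minus g_j, and moves `pairSq` = ab by i ab.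
    have h1 := hpair j (Complex.I * (z (fstIdx j) + Complex.I * z (sndIdx j)) / 2)
      ((z (fstIdx j) + Complex.I * z (sndIdx j)) / 2)
    have e1 : 2 * (z (fstIdx j) * (Complex.I * (z (fstIdx j) + Complex.I * z (sndIdx j)) / 2) +
        z (sndIdx j) * ((z (fstIdx j) + Complex.I * z (sndIdx j)) / 2)) =
        Complex.I * pairSq j z := by
      rw [pairSq]
      linear_combination (z (fstIdx j) * z (sndIdx j)) * Complex.I_sq
    rw [e1] at h1
    have e2 : fderiv ℝ (ustilovskyG j) z (pairVec j
        (Complex.I * (z (fstIdx j) + Complex.I * z (sndIdx j)) / 2)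
        ((z (fstIdx j) + Complex.I * z (sndIdx j)) / 2)) = 0 := by
      simp [fderiv_ustilovskyG, pairVec]
      ring
    have e3 : fderiv ℝ (pairNormSq j) z (pairVec j
        (Complex.I * (z (fstIdx j) + Complex.I * z (sndIdx j)) / 2)
        ((z (fstIdx j) + Complex.I * z (sndIdx j)) / 2)) = 0 := by
      simp [fderiv_pairNormSq, pairVec]
      ring
    rw [e2, e3, mul_assoc Complex.I, Complex.I_mul_im, mul_left_comm μ, Complex.I_mul_re] at h1
    linarith
  have hp' : (p : ℝ) ≠ 0 := Nat.cast_ne_zero.2 hp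
  -- Turning z_0 alone gives Im (μ z_0^p) = 0. Turning the first pair, for which τ = 0, gives Im (μ
  -- `pairSq`) = 0.
  have hμ : μ = 0 := by
    refine eq_zero_of_im_mul_eq_zero (x := z 0 ^ p) ?_ ?_ hgen
    · have h1 := h01 (Complex.I * z 0) 0
      have e : (μ * (p * z 0 ^ (p - 1) * (Complex.I * z 0) + 2 * z 1 * 0)).re =
          -(p * (μ * z 0 ^ p).im) := by
        rw [← Complex.im_ofReal_mul, ← Complex.I_mul_re, ← hpow]
        congr 1
        push_cast
        ring
      rw [e] at h1
      have h2 : (p : ℝ) * (μ * z 0 ^ p).im = 0 := by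
        simp only [mul_zero, map_zero, Complex.zero_im, Complex.zero_re, Complex.I_mul_re,
          Complex.I_mul_im, Finset.sum_const_zero] at h1
        linarith
      exact (mul_eq_zero.1 h2).resolve_left hp'
    · have h1 := hrot ⟨0, hm⟩
      rw [hτ, zero_mul] at h1
      linarith
  have hτ0 : τ = 0 := by
    ext j
    by_cases hj : (j : ℕ) = 0
    · rw [show j = ⟨0, hm⟩ from Fin.ext hj, hτ, Pi.zero_apply]
    · have h1 := hrot j
      have h2 := hzj j
      rw [if_neg hj] at h2
      rw [hμ, zero_mul, Complex.zero_im, neg_zero] at h1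
      exact (mul_eq_zero.1 h1).resolve_right h2
  subst hμ hτ0
  simp only [Pi.zero_apply, zero_mul, Finset.sum_const_zero, zero_add, Complex.zero_re,
    add_zero] at h01 hpair
  have hl : l = 0 := by
    have h1 := h01 (z 0) 0
    have h2 : l * (2 * Complex.normSq (z 0)) = 0 := by
      rw [Complex.normSq_apply]
      simp only [Complex.zero_re, Complex.zero_im, mul_zero, add_zero] at h1
      linarith
    exact (mul_eq_zero.1 h2).resolve_right (mul_ne_zero two_ne_zero
      (Complex.normSq_pos.2 hz0).ne')
  have hσ : σ = 0 := by
    have h1 := h01 0 (z 1)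
    have h2 : σ * (2 * Complex.normSq (z 1)) = 0 := by
      rw [Complex.normSq_apply, h1, hl, zero_mul]
    exact (mul_eq_zero.1 h2).resolve_right (mul_ne_zero two_ne_zero
      (Complex.normSq_pos.2 hz1).ne')
  have hP : ∀ j, pairSq j z ≠ 0 := by
    intro j h0
    have h1 := hzj j
    rw [h0] at h1
    split_ifs at h1 <;> simp at h1
  have hfac : ∀ j, pairSq j z = (z (fstIdx j) + Complex.I * z (sndIdx j)) *
      (z (fstIdx j) - Complex.I * z (sndIdx j)) := by
    intro j
    rw [pairSq]
    linear_combination (z (sndIdx j)) ^ 2 * Complex.I_sq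
  have hplus : ∀ j, γ j + η j = 0 := by
    intro j
    have h0 : z (fstIdx j) + Complex.I * z (sndIdx j) ≠ 0 := by
      intro h0
      exact hP j (by rw [hfac, h0, zero_mul])
    -- Stretching a with b fixed isolates γ + η, since only |a|² changes; stretching b below
    -- isolates η - γ.
    have h1 := hpair j ((z (fstIdx j) + Complex.I * z (sndIdx j)) / 2)
      (-Complex.I * (z (fstIdx j) + Complex.I * z (sndIdx j)) / 2)
    refine (mul_eq_zero.1 (?_ : (γ j + η j) *
      Complex.normSq (z (fstIdx j) + Complex.I * z (sndIdx j)) = 0)).resolve_right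
      (Complex.normSq_pos.2 h0).ne'
    rw [hl, zero_mul] at h1
    rw [← h1, Complex.normSq_apply, fderiv_ustilovskyG, fderiv_pairNormSq]
    simp [pairVec]
    ring
  have hminus : ∀ j, η j - γ j = 0 := by
    intro j
    have h0 : z (fstIdx j) - Complex.I * z (sndIdx j) ≠ 0 := by
      intro h0
      exact hP j (by rw [hfac, h0, mul_zero])
    have h1 := hpair j ((z (fstIdx j) - Complex.I * z (sndIdx j)) / 2)
      (Complex.I * (z (fstIdx j) - Complex.I * z (sndIdx j)) / 2)
    refine (mul_eq_zero.1 (?_ : (η j - γ j) *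
      Complex.normSq (z (fstIdx j) - Complex.I * z (sndIdx j)) = 0)).resolve_right
      (Complex.normSq_pos.2 h0).ne'
    rw [hl, zero_mul] at h1
    rw [← h1, Complex.normSq_apply, fderiv_ustilovskyG, fderiv_pairNormSq]
    simp [pairVec]
    ring
  refine ⟨?_, ?_, rfl, hσ⟩
  · ext j
    rw [Pi.zero_apply]
    linarith [hplus j, hminus j]
  · ext j
    rw [Pi.zero_apply]
    linarith [hplus j, hminus j]

end Integrals

/-! ### Density of the generic points -/

section Density

open ComplexConjugate Filter Topology

/-- This allows the open conditions to be imposed one at a time; `A'` keeps only those already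
imposed that the next perturbation needs. -/
theorem subset_closure_inter_of_subset {X : Type*} [TopologicalSpace X] {V A A' B : Set X}
    (hA : IsOpen A) (hV : V ⊆ closure (V ∩ A)) (hAA' : A ⊆ A')
    (hB : V ∩ A' ⊆ closure (V ∩ B)) : V ⊆ closure (V ∩ (A ∩ B)) := by
  refine hV.trans (closure_minimal ?_ isClosed_closure)
  rintro x ⟨hxV, hxA⟩
  have h := hA.inter_closure ⟨hxA, hB ⟨hxV, hAA' hxA⟩⟩
  refine closure_mono ?_ h
  rintro y ⟨hyA, hyV, hyB⟩
  exact ⟨hyV, hyA, hyB⟩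

theorem mem_closure_of_curve {X : Type*} [TopologicalSpace X] {V B : Set X} {c : ℝ → X} {x : X}
    (hc : Continuous c) (h0 : c 0 = x) (hV : ∀ t, c t ∈ V) (hB : ∃ᶠ t in 𝓝 0, c t ∈ B) :
    x ∈ closure (V ∩ B) := by
  rw [mem_closure_iff_frequently, ← h0]
  exact hc.continuousAt.frequently (hB.mono fun t ht => ⟨hV t, ht⟩)

/-- If the expression vanished at t and at -t, the sum of the two values would give 2 t² y = 0. -/
theorem frequently_quadratic_ne_zero {E : Type*} [AddCommGroup E] [Module ℝ E] (x : E) {y : E}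
    (hy : y ≠ 0) : ∃ᶠ t : ℝ in 𝓝 0, t • x + t ^ 2 • y ≠ 0 := by
  intro h
  obtain ⟨δ, hδ, hb⟩ := Metric.eventually_nhds_iff.1 h
  have h1 := hb (y := δ / 2) (by rw [Real.dist_eq, sub_zero, abs_of_pos (by linarith)]; linarith)
  have h2 := hb (y := -(δ / 2))
    (by rw [Real.dist_eq, sub_zero, abs_neg, abs_of_pos (by linarith)]; linarith)
  rw [not_not] at h1 h2
  apply hy
  have h3 : (2 * (δ / 2) ^ 2) • y = 0 := by
    rw [← add_zero (0 : E)]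
    nth_rewrite 1 [← h1]
    rw [← h2]
    module
  exact (smul_eq_zero.1 h3).resolve_left (by positivity)

variable {m p : ℕ}

/-- The cone over `B_p`. -/
def ustilovskyCone (m p : ℕ) : Set (Fin (2 * m + 2) → ℂ) :=
  {z | ∑ k, z k ^ ustilovskyExp m p k = 0}

theorem sum_pow_update {ι : Type*} [Fintype ι] [DecidableEq ι] (a : ι → ℕ) (z : ι → ℂ) (k : ι)
    (y : ℂ) : ∑ i, Function.update z k y i ^ a i = ∑ i, z i ^ a i - z k ^ a k + y ^ a k := by
  rw [← Finset.add_sum_erase _ _ (Finset.mem_univ k),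
    ← Finset.add_sum_erase _ (fun i => z i ^ a i) (Finset.mem_univ k), Function.update_self,
    Finset.sum_congr rfl fun i hi => by rw [Function.update_of_ne (Finset.ne_of_mem_erase hi)]]
  ring

/-- Move the `k`-th coordinate by `y` and the `j`-th pair by `d / 2 • (1, s)`. -/
def moveCoord (j : Fin m) (s : ℂ) (k : Fin (2 * m + 2)) (z : Fin (2 * m + 2) → ℂ) (y d : ℂ) :
    Fin (2 * m + 2) → ℂ :=
  Function.update (Function.update (Function.update z k (z k + y))
    (fstIdx j) (z (fstIdx j) + d / 2)) (sndIdx j) (z (sndIdx j) + s * d / 2)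

theorem fstIdx_ne_sndIdx (i j : Fin m) : fstIdx i ≠ sndIdx j := by
  intro h
  have := congrArg Fin.val h
  simp [fstIdx, sndIdx] at this
  omega

theorem fstIdx_injective : Function.Injective (fstIdx : Fin m → Fin (2 * m + 2)) := by
  intro i j h
  have := congrArg Fin.val h
  simp [fstIdx] at this
  exact Fin.ext this

theorem sndIdx_injective : Function.Injective (sndIdx : Fin m → Fin (2 * m + 2)) := by
  intro i j h
  have := congrArg Fin.val h
  simp [sndIdx] at this
  exact Fin.ext this

theorem one_ne_fstIdx (j : Fin m) : (1 : Fin (2 * m + 2)) ≠ fstIdx j := by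
  intro h
  have h := congrArg Fin.val h
  have h1 : ((1 : Fin (2 * m + 2)) : ℕ) = 1 := rfl
  rw [h1] at h
  simp [fstIdx] at h
  omega

theorem one_ne_sndIdx (j : Fin m) : (1 : Fin (2 * m + 2)) ≠ sndIdx j := by
  intro h
  have h := congrArg Fin.val h
  have h1 : ((1 : Fin (2 * m + 2)) : ℕ) = 1 := rfl
  rw [h1] at h
  simp [sndIdx] at h

section Move

variable {j : Fin m} {s : ℂ} {k : Fin (2 * m + 2)} {z : Fin (2 * m + 2) → ℂ} {y d : ℂ}

theorem moveCoord_fst : moveCoord j s k z y d (fstIdx j) = z (fstIdx j) + d / 2 := by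
  rw [moveCoord, Function.update_of_ne (fstIdx_ne_sndIdx j j), Function.update_self]

theorem moveCoord_snd : moveCoord j s k z y d (sndIdx j) = z (sndIdx j) + s * d / 2 := by
  rw [moveCoord, Function.update_self]

theorem moveCoord_self (hk1 : k ≠ fstIdx j) (hk2 : k ≠ sndIdx j) :
    moveCoord j s k z y d k = z k + y := by
  rw [moveCoord, Function.update_of_ne hk2, Function.update_of_ne hk1, Function.update_self]

theorem moveCoord_of_ne {i : Fin (2 * m + 2)} (hi : i ≠ k) (hi1 : i ≠ fstIdx j)
    (hi2 : i ≠ sndIdx j) : moveCoord j s k z y d i = z i := by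
  rw [moveCoord, Function.update_of_ne hi2, Function.update_of_ne hi1, Function.update_of_ne hi]

theorem moveCoord_zero : moveCoord j s k z 0 0 = z := by
  rw [moveCoord]
  simp

/-- The direction (1, s) is isotropic for the quadratic form, so the polynomial is affine in `d`.
One can solve for `d` to compensate the change of z_k wherever z_{2j} + s z_{2j+1} ≠ 0. -/
theorem sum_pow_moveCoord (hs : s ^ 2 = -1) (hk1 : k ≠ fstIdx j) (hk2 : k ≠ sndIdx j) :
    ∑ i, moveCoord j s k z y d i ^ ustilovskyExp m p i =
      ∑ i, z i ^ ustilovskyExp m p i +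
        ((z k + y) ^ ustilovskyExp m p k - z k ^ ustilovskyExp m p k) +
        d * (z (fstIdx j) + s * z (sndIdx j)) := by
  rw [moveCoord, sum_pow_update, sum_pow_update, sum_pow_update,
    Function.update_of_ne (fstIdx_ne_sndIdx j j).symm, Function.update_of_ne hk1.symm,
    Function.update_of_ne hk2.symm]
  simp only [ustilovskyExp_fstIdx, ustilovskyExp_sndIdx]
  linear_combination (d ^ 2 / 4) * hs

theorem pairSq_moveCoord (hs : s ^ 2 = -1) :
    pairSq j (moveCoord j s k z y d) = pairSq j z + d * (z (fstIdx j) + s * z (sndIdx j)) := by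
  rw [pairSq, pairSq, moveCoord_fst, moveCoord_snd]
  linear_combination (d ^ 2 / 4) * hs

theorem continuous_moveCoord {y d : ℝ → ℂ} (hy : Continuous y) (hd : Continuous d) :
    Continuous fun t => moveCoord j s k z (y t) (d t) := by
  unfold moveCoord
  fun_prop

end Move

theorem subset_closure_ne_zero_pair (j : Fin m) :
    ustilovskyCone m p ⊆ closure (ustilovskyCone m p ∩
      {z | z (fstIdx j) + -Complex.I * z (sndIdx j) ≠ 0}) := by
  intro z hz
  by_cases hv : z (fstIdx j) + -Complex.I * z (sndIdx j) = 0
  swap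
  · exact subset_closure ⟨hz, hv⟩
  have hz' : ∑ k, z k ^ ustilovskyExp m p k = 0 := hz
  have hmv : ∀ y d : ℂ, moveCoord j Complex.I 1 z y d (fstIdx j) +
      -Complex.I * moveCoord j Complex.I 1 z y d (sndIdx j) = d := by
    intro y d
    rw [moveCoord_fst, moveCoord_snd]
    linear_combination hv - (d / 2) * Complex.I_sq
  have hsum := fun y d : ℂ => sum_pow_moveCoord (p := p) (z := z) (y := y) (d := d) Complex.I_sq
    (one_ne_fstIdx j) (one_ne_sndIdx j)
  simp only [hz', ustilovskyExp_one] at hsum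
  -- Along (1, i) the number z_{2j} - i z_{2j+1} changes by exactly `d`. If z_{2j} + i z_{2j+1} = 0,
  -- then `d` is free. Otherwise z_1 moves by t, and the compensating `d` is nonzero for arbitrarily
  -- small t.
  by_cases hu : z (fstIdx j) + Complex.I * z (sndIdx j) = 0
  · refine mem_closure_of_curve (c := fun t => moveCoord j Complex.I 1 z 0 t)
      (continuous_moveCoord continuous_const Complex.continuous_ofReal) (by simp [moveCoord_zero])
      (fun t => ?_) ?_
    · change ∑ i, _ = (0 : ℂ)
      rw [hsum, hu]
      ring
    · refine (frequently_quadratic_ne_zero (0 : ℂ) (one_ne_zero (α := ℂ))).mono fun t ht => ?_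
      change moveCoord j Complex.I 1 z 0 t (fstIdx j) + _ ≠ 0
      rw [hmv]
      intro h0
      exact ht (by simp [Complex.ofReal_eq_zero.1 h0])
  · refine mem_closure_of_curve (c := fun t : ℝ => moveCoord j Complex.I 1 z t
      (-((z 1 + t) ^ 2 - z 1 ^ 2) / (z (fstIdx j) + Complex.I * z (sndIdx j))))
      (continuous_moveCoord (by fun_prop) (by fun_prop)) (by simp [moveCoord_zero])
      (fun t => ?_) ?_
    · change ∑ i, _ = (0 : ℂ)
      rw [hsum]
      field_simp
      ring
    · refine (frequently_quadratic_ne_zero (2 * z 1) (one_ne_zero (α := ℂ))).mono fun t ht => ?_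
      change moveCoord j Complex.I 1 z _ _ (fstIdx j) + _ ≠ 0
      rw [hmv]
      intro h0
      apply ht
      rw [div_eq_zero_iff, or_iff_left hu] at h0
      simp only [Complex.real_smul, Complex.ofReal_pow]
      linear_combination -h0

/-- On the cone each coordinate may be moved freely where `z_{2j} - i z_{2j+1} ≠ 0`, if the
`j`-th pair is moved along. -/
theorem mem_closure_of_moveCoord {j : Fin m} {k : Fin (2 * m + 2)} (hk1 : k ≠ fstIdx j)
    (hk2 : k ≠ sndIdx j) {z : Fin (2 * m + 2) → ℂ} (hz : z ∈ ustilovskyCone m p)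
    (hv : z (fstIdx j) + -Complex.I * z (sndIdx j) ≠ 0) (x : ℂ) {B : Set (Fin (2 * m + 2) → ℂ)}
    (hB : ∃ᶠ t : ℝ in 𝓝 0, ∀ w : Fin (2 * m + 2) → ℂ, w k = z k + t * x →
      (∀ i, i ≠ k → i ≠ fstIdx j → i ≠ sndIdx j → w i = z i) →
      pairSq j w = pairSq j z -
        ((z k + t * x) ^ ustilovskyExp m p k - z k ^ ustilovskyExp m p k) → w ∈ B) :
    z ∈ closure (ustilovskyCone m p ∩ B) := by
  have hz' : ∑ k, z k ^ ustilovskyExp m p k = 0 := hz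
  have hs : (-Complex.I) ^ 2 = -1 := by rw [neg_sq, Complex.I_sq]
  refine mem_closure_of_curve (c := fun t : ℝ => moveCoord j (-Complex.I) k z (t * x)
    (-((z k + t * x) ^ ustilovskyExp m p k - z k ^ ustilovskyExp m p k) /
      (z (fstIdx j) + -Complex.I * z (sndIdx j))))
    (continuous_moveCoord (by fun_prop) (by fun_prop)) (by simp [moveCoord_zero])
    (fun t => ?_) (hB.mono fun t ht => ht _ ?_ ?_ ?_)
  · change ∑ i, _ = (0 : ℂ)
    rw [sum_pow_moveCoord hs hk1 hk2, hz', div_mul_cancel₀ _ hv]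
    ring
  · exact moveCoord_self hk1 hk2
  · exact fun i hi hi1 hi2 => moveCoord_of_ne hi hi1 hi2
  · rw [pairSq_moveCoord hs, div_mul_cancel₀ _ hv]
    ring

theorem isOpen_genericSet (m p : ℕ) : IsOpen (genericSet m p) := by
  have hP : ∀ j : Fin m, Continuous (pairSq j) := fun j => (contDiff_pairSq j).continuous
  have : genericSet m p = {z | z 1 ≠ 0} ∩ ⋂ j : Fin m,
      {z | if (j : ℕ) = 0 then (conj (z 0 ^ p) * pairSq j z).im ≠ 0
        else (pairSq j z * conj (z 1 ^ 2)).re ≠ 0} := by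
    ext z
    simp [genericSet]
  rw [this]
  refine (isOpen_ne_fun (continuous_apply 1) continuous_const).inter
    (isOpen_iInter_of_finite fun j => ?_)
  by_cases hj : (j : ℕ) = 0
  · simp only [hj, if_true]
    exact isOpen_ne_fun (Complex.continuous_im.comp
      ((Complex.continuous_conj.comp ((continuous_apply 0).pow p)).mul (hP j))) continuous_const
  · simp only [hj, if_false]
    exact isOpen_ne_fun (Complex.continuous_re.comp ((hP j).mul
      (Complex.continuous_conj.comp ((continuous_apply 1).pow 2)))) continuous_const

/-- The condition `A₁` on the first pair comes first: it lets this pair absorb the perturbation of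
any coordinate outside it. Each later condition is then obtained along a curve on which the tested
quantity is linear, or quadratic with nonzero leading coefficient. -/
theorem ustilovskyCone_subset_closure (hm : 0 < m) :
    ustilovskyCone m p ⊆ closure (ustilovskyCone m p ∩ genericSet m p) := by
  set j₀ : Fin m := ⟨0, hm⟩ with hj₀
  set V := ustilovskyCone m p
  let A₁ : Set (Fin (2 * m + 2) → ℂ) := {z | z (fstIdx j₀) + -Complex.I * z (sndIdx j₀) ≠ 0}
  let B₀ : Set (Fin (2 * m + 2) → ℂ) := {z | z 0 ≠ 0}
  let B₁ : Set (Fin (2 * m + 2) → ℂ) := {z | z 1 ≠ 0}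
  let C : Set (Fin (2 * m + 2) → ℂ) := {z | (conj (z 0 ^ p) * pairSq j₀ z).im ≠ 0}
  let D : Fin m → Set (Fin (2 * m + 2) → ℂ) := fun j =>
    {z | (j : ℕ) ≠ 0 → (pairSq j z * conj (z 1 ^ 2)).re ≠ 0}
  have hP : ∀ j : Fin m, Continuous (pairSq j) := fun j => (contDiff_pairSq j).continuous
  have oA₁ : IsOpen A₁ := isOpen_ne_fun (by fun_prop) continuous_const
  have oB₀ : IsOpen B₀ := isOpen_ne_fun (continuous_apply 0) continuous_const
  have oB₁ : IsOpen B₁ := isOpen_ne_fun (continuous_apply 1) continuous_const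
  have oC : IsOpen C := isOpen_ne_fun (Complex.continuous_im.comp
      ((Complex.continuous_conj.comp ((continuous_apply 0).pow p)).mul (hP j₀))) continuous_const
  have oD : ∀ j, IsOpen (D j) := by
    intro j
    by_cases hj : (j : ℕ) = 0
    · simp [D, hj]
    · simp only [D, ne_eq, hj, not_false_eq_true, true_implies]
      exact isOpen_ne_fun (Complex.continuous_re.comp ((hP j).mul
        (Complex.continuous_conj.comp ((continuous_apply 1).pow 2)))) continuous_const
  have hlin : ∃ᶠ t : ℝ in 𝓝 0, t ≠ 0 :=
    (frequently_quadratic_ne_zero (0 : ℝ) one_ne_zero).mono fun t ht h0 => ht (by simp [h0])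
  have s₁ : V ⊆ closure (V ∩ A₁) := subset_closure_ne_zero_pair j₀
  have s₂ : V ⊆ closure (V ∩ (A₁ ∩ B₀)) := by
    refine subset_closure_inter_of_subset oA₁ s₁ subset_rfl ?_
    rintro z ⟨hz, hv⟩
    by_cases h0 : z 0 = 0
    swap
    · exact subset_closure ⟨hz, h0⟩
    refine mem_closure_of_moveCoord (fstIdx_ne_zero j₀).symm (sndIdx_ne_zero j₀).symm hz hv 1
      (hlin.mono fun t ht w hw _ _ => ?_)
    change w 0 ≠ 0
    simpa [hw, h0] using ht
  have s₃ : V ⊆ closure (V ∩ (A₁ ∩ B₀ ∩ B₁)) := by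
    refine subset_closure_inter_of_subset (oA₁.inter oB₀) s₂ Set.inter_subset_left ?_
    rintro z ⟨hz, hv⟩
    by_cases h0 : z 1 = 0
    swap
    · exact subset_closure ⟨hz, h0⟩
    refine mem_closure_of_moveCoord (one_ne_fstIdx j₀) (one_ne_sndIdx j₀) hz hv 1
      (hlin.mono fun t ht w hw _ _ => ?_)
    change w 1 ≠ 0
    simpa [hw, h0] using ht
  have s₄ : V ⊆ closure (V ∩ (A₁ ∩ B₀ ∩ B₁ ∩ C)) := by
    refine subset_closure_inter_of_subset ((oA₁.inter oB₀).inter oB₁) s₃ Set.inter_subset_left ?_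
    rintro z ⟨hz, hv, hz0⟩
    by_cases h0 : (conj (z 0 ^ p) * pairSq j₀ z).im = 0
    swap
    · exact subset_closure ⟨hz, h0⟩
    -- Moving z_1 by t x changes the square of the first pair by -t² x² up to a linear term. With x²
    -- = i z_0^p the t² coefficient of the tested imaginary part is -|z_0^p|² ≠ 0.
    obtain ⟨x, hx⟩ := IsAlgClosed.exists_pow_nat_eq (Complex.I * z 0 ^ p) two_pos
    have hne : -Complex.normSq (z 0 ^ p) ≠ 0 :=
      neg_ne_zero.2 (Complex.normSq_pos.2 (pow_ne_zero p hz0)).ne'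
    refine mem_closure_of_moveCoord (one_ne_fstIdx j₀) (one_ne_sndIdx j₀) hz hv x
      ((frequently_quadratic_ne_zero ((conj (z 0 ^ p) * (-2 * z 1 * x)).im) hne).mono
        fun t ht w _ hw hwP => ?_)
    change (conj (w 0 ^ p) * pairSq j₀ w).im ≠ 0
    have h01 : (0 : Fin (2 * m + 2)) ≠ 1 := by simp
    rw [hwP, hw 0 h01 (fstIdx_ne_zero j₀).symm (sndIdx_ne_zero j₀).symm, ustilovskyExp_one]
    have e : conj (z 0 ^ p) * (pairSq j₀ z - ((z 1 + t * x) ^ 2 - z 1 ^ 2)) =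
        conj (z 0 ^ p) * pairSq j₀ z + t * (conj (z 0 ^ p) * (-2 * z 1 * x)) +
          ((t ^ 2 : ℝ) : ℂ) * (-Complex.I * Complex.normSq (z 0 ^ p)) := by
      rw [Complex.normSq_eq_conj_mul_self]
      push_cast
      linear_combination (-(conj (z 0 ^ p)) * t ^ 2) * hx
    have e' : ∀ r : ℝ, (-Complex.I * (r : ℂ)).im = -r := fun r => by simp
    rw [e, Complex.add_im, Complex.add_im, h0, Complex.im_ofReal_mul, Complex.im_ofReal_mul, e',
      zero_add]
    exact ht
  have s₅ : ∀ S : Finset (Fin m),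
      V ⊆ closure (V ∩ (A₁ ∩ B₀ ∩ B₁ ∩ C ∩ ⋂ j ∈ S, D j)) := by
    intro S
    induction S using Finset.induction_on with
    | empty => simpa using s₄
    | insert j S _ ih =>
      have oS : IsOpen (A₁ ∩ B₀ ∩ B₁ ∩ C ∩ ⋂ j ∈ S, D j) :=
        (((oA₁.inter oB₀).inter oB₁).inter oC).inter (isOpen_biInter_finset fun j _ => oD j)
      have h := subset_closure_inter_of_subset (A' := A₁ ∩ B₀ ∩ B₁) (B := D j) oS ih
        (fun z hz => hz.1.1) ?_
      · refine h.trans (closure_mono ?_)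
        rintro z ⟨hz, ⟨hz1, hz2⟩, hz3⟩
        refine ⟨hz, hz1, ?_⟩
        rw [Finset.set_biInter_insert]
        exact ⟨hz3, hz2⟩
      · rintro z ⟨hz, ⟨hv, _⟩, hz1⟩
        by_cases hj : (j : ℕ) = 0
        · exact subset_closure ⟨hz, fun h => absurd hj h⟩
        by_cases h0 : (pairSq j z * conj (z 1 ^ 2)).re = 0
        swap
        · exact subset_closure ⟨hz, fun _ => h0⟩
        have hjj : j ≠ j₀ := fun h => hj (by rw [h, hj₀])
        have hne : Complex.normSq (z 1 ^ 2) ≠ 0 := (Complex.normSq_pos.2 (pow_ne_zero 2 hz1)).ne'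
        -- Moving z_{2j} in the direction z_1 gives the tested real part the t² coefficient |z_1²|²
        -- ≠ 0; the first pair compensates.
        refine mem_closure_of_moveCoord (fun h => hjj (fstIdx_injective h))
          (fstIdx_ne_sndIdx j j₀) hz hv (z 1)
          ((frequently_quadratic_ne_zero
            ((2 * z (fstIdx j) * z 1 * conj (z 1 ^ 2)).re) hne).mono fun t ht w hw1 hw2 _ _ => ?_)
        have e1 : w 1 = z 1 := hw2 1 (one_ne_fstIdx j) (one_ne_fstIdx j₀) (one_ne_sndIdx j₀)
        have e2 : w (sndIdx j) = z (sndIdx j) := hw2 _ (fstIdx_ne_sndIdx j j).symm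
          (fstIdx_ne_sndIdx j₀ j).symm (fun h => hjj (sndIdx_injective h))
        have e : pairSq j w * conj (w 1 ^ 2) = pairSq j z * conj (z 1 ^ 2) +
            t * (2 * z (fstIdx j) * z 1 * conj (z 1 ^ 2)) +
            ((t ^ 2 * Complex.normSq (z 1 ^ 2) : ℝ) : ℂ) := by
          rw [pairSq, pairSq, hw1, e1, e2]
          push_cast
          rw [Complex.normSq_eq_conj_mul_self]
          ring
        rw [e, Complex.add_re, Complex.add_re, h0, Complex.re_ofReal_mul, Complex.ofReal_re]
        simpa using ht
  refine (s₅ Finset.univ).trans (closure_mono ?_)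
  rintro z ⟨hz, ⟨⟨_, hz1⟩, hC⟩, hD⟩
  refine ⟨hz, hz1, fun j => ?_⟩
  split_ifs with hj
  · rw [show j = j₀ from Fin.ext hj]
    exact hC
  · exact Set.mem_iInter₂.1 hD j (Finset.mem_univ j) hj

/-- The weighted scaling of the cone. -/
def coneScale (m p : ℕ) (r : ℝ) (z : Fin (2 * m + 2) → ℂ) : Fin (2 * m + 2) → ℂ :=
  fun k => ((if k = 0 then r ^ 2 else r ^ p : ℝ) : ℂ) * z k

theorem continuous_coneScale :
    Continuous fun x : ℝ × (Fin (2 * m + 2) → ℂ) => coneScale m p x.1 x.2 := by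
  refine continuous_pi fun k => ?_
  unfold coneScale
  split_ifs <;> fun_prop

theorem coneScale_zero (r : ℝ) (z : Fin (2 * m + 2) → ℂ) :
    coneScale m p r z 0 = ((r ^ 2 : ℝ) : ℂ) * z 0 := by
  simp [coneScale]

theorem coneScale_of_ne {k : Fin (2 * m + 2)} (hk : k ≠ 0) (r : ℝ) (z : Fin (2 * m + 2) → ℂ) :
    coneScale m p r z k = ((r ^ p : ℝ) : ℂ) * z k := by
  simp [coneScale, hk]

theorem coneScale_one (z : Fin (2 * m + 2) → ℂ) : coneScale m p 1 z = z := by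
  ext k
  simp [coneScale]

theorem pairSq_coneScale (r : ℝ) (z : Fin (2 * m + 2) → ℂ) (j : Fin m) :
    pairSq j (coneScale m p r z) = ((r ^ (2 * p) : ℝ) : ℂ) * pairSq j z := by
  rw [pairSq, pairSq, coneScale_of_ne (fstIdx_ne_zero j), coneScale_of_ne (sndIdx_ne_zero j)]
  push_cast
  ring

/-- The weights 2 for z_0 and p for the other coordinates multiply every term by r^(2p). -/
theorem coneScale_mem_cone {r : ℝ} {z : Fin (2 * m + 2) → ℂ} (hz : z ∈ ustilovskyCone m p) :
    coneScale m p r z ∈ ustilovskyCone m p := by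
  have hz' : ∑ k, z k ^ ustilovskyExp m p k = 0 := hz
  change ∑ k, coneScale m p r z k ^ ustilovskyExp m p k = 0
  rw [← mul_zero ((r ^ (2 * p) : ℝ) : ℂ), ← hz', Finset.mul_sum]
  refine Finset.sum_congr rfl fun k _ => ?_
  rw [coneScale, ustilovskyExp]
  split_ifs <;> push_cast <;> ring

theorem coneScale_mem_genericSet {r : ℝ} (hr : 0 < r) {z : Fin (2 * m + 2) → ℂ}
    (hz : z ∈ genericSet m p) : coneScale m p r z ∈ genericSet m p := by
  have h10 : (1 : Fin (2 * m + 2)) ≠ 0 := by simp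
  refine ⟨?_, fun j => ?_⟩
  · rw [coneScale_of_ne h10]
    exact mul_ne_zero (Complex.ofReal_ne_zero.2 (pow_ne_zero p hr.ne')) hz.1
  · have h := hz.2 j
    split_ifs at h ⊢ with hj
    · have e : conj (coneScale m p r z 0 ^ p) * pairSq j (coneScale m p r z) =
          ((r ^ (4 * p) : ℝ) : ℂ) * (conj (z 0 ^ p) * pairSq j z) := by
        rw [pairSq_coneScale, coneScale_zero, mul_pow, map_mul, ← Complex.ofReal_pow,
          Complex.conj_ofReal]
        push_cast
        ring
      rw [e, Complex.im_ofReal_mul]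
      exact mul_ne_zero (pow_ne_zero _ hr.ne') h
    · have e : pairSq j (coneScale m p r z) * conj (coneScale m p r z 1 ^ 2) =
          ((r ^ (4 * p) : ℝ) : ℂ) * (pairSq j z * conj (z 1 ^ 2)) := by
        rw [pairSq_coneScale, coneScale_of_ne h10, mul_pow, map_mul, ← Complex.ofReal_pow,
          Complex.conj_ofReal]
        push_cast
        ring
      rw [e, Complex.re_ofReal_mul]
      exact mul_ne_zero (pow_ne_zero _ hr.ne') h

theorem sqNorm_coneScale (r : ℝ) (z : Fin (2 * m + 2) → ℂ) :
    sqNorm (coneScale m p r z) =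
      ∑ k, (if k = 0 then r ^ 2 else r ^ p : ℝ) ^ 2 * Complex.normSq (z k) := by
  rw [sqNorm]
  refine Finset.sum_congr rfl fun k _ => ?_
  rw [coneScale, map_mul, Complex.normSq_ofReal, ← sq]

theorem lt_sqNorm_coneScale (hp : p ≠ 0) {r : ℝ} (hr : 1 < r) {z : Fin (2 * m + 2) → ℂ}
    (hz : sqNorm z = 1) : 1 < sqNorm (coneScale m p r z) := by
  have hr0 : 0 ≤ r := by linarith
  calc 1 < r ^ 2 * sqNorm z := by rw [hz]; nlinarith
    _ ≤ _ := by
      rw [sqNorm_coneScale, sqNorm, Finset.mul_sum]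
      refine Finset.sum_le_sum fun k _ =>
        mul_le_mul_of_nonneg_right (pow_le_pow_left₀ hr0 ?_ 2) (Complex.normSq_nonneg _)
      split_ifs
      · exact le_self_pow₀ hr.le two_ne_zero
      · exact le_self_pow₀ hr.le hp

theorem sqNorm_coneScale_lt (hp : p ≠ 0) {r : ℝ} (hr0 : 0 ≤ r) (hr : r < 1)
    {z : Fin (2 * m + 2) → ℂ} (hz : sqNorm z = 1) : sqNorm (coneScale m p r z) < 1 := by
  calc _ ≤ r ^ 2 * sqNorm z := by
        rw [sqNorm_coneScale, sqNorm, Finset.mul_sum]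
        refine Finset.sum_le_sum fun k _ =>
          mul_le_mul_of_nonneg_right (pow_le_pow_left₀ (by positivity) ?_ 2)
            (Complex.normSq_nonneg _)
        split_ifs
        · exact pow_le_of_le_one hr0 hr.le two_ne_zero
        · exact pow_le_of_le_one hr0 hr.le hp
    _ < 1 := by rw [hz]; nlinarith

/-- The generic points are dense in `B_p`. -/
theorem carrier_subset_closure_generic (hp : p ≠ 0) (hm : 0 < m) :
    (ustilovsky m p).carrier ⊆ closure ((ustilovsky m p).carrier ∩ genericSet m p) := by
  intro z hz
  obtain ⟨hz1, hz2⟩ := mem_ustilovsky_carrier.1 hz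
  rw [← sum_pow_ustilovskyExp] at hz2
  have hcl := ustilovskyCone_subset_closure hm hz2
  rw [mem_closure_iff_nhds] at hcl ⊢
  intro N hN
  have hcont : Tendsto (fun x : ℝ × (Fin (2 * m + 2) → ℂ) => coneScale m p x.1 x.2)
      (𝓝 1 ×ˢ 𝓝 z) (𝓝 z) := by
    have h := (continuous_coneScale (m := m) (p := p)).tendsto (1, z)
    rwa [nhds_prod_eq, coneScale_one] at h
  obtain ⟨R, hR, W, hW, hRW⟩ := Filter.eventually_prod_iff.1 (hcont.eventually hN)
  obtain ⟨δ, hδ, hball⟩ := Metric.eventually_nhds_iff.1 hR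
  -- Factors within ρ of 1 keep points of `W` in `N`, and ρ ≤ 1/2 keeps the factors positive.
  set ρ := min (δ / 2) (1 / 2) with hρ
  have hρ0 : 0 < ρ := lt_min (by linarith) (by norm_num)
  have hρδ : ρ < δ := lt_of_le_of_lt (min_le_left _ _) (by linarith)
  have hρ1 : ρ ≤ 1 / 2 := min_le_right _ _
  have hF : ∀ r, Continuous fun w : Fin (2 * m + 2) → ℂ => sqNorm (coneScale m p r w) :=
    fun r => contDiff_sqNorm.continuous.comp
      (continuous_coneScale.comp (continuous_const.prodMk continuous_id))
  have h1 : ∀ᶠ w in 𝓝 z, 1 < sqNorm (coneScale m p (1 + ρ) w) :=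
    (hF _).continuousAt.eventually_const_lt (lt_sqNorm_coneScale hp (by linarith) hz1)
  have h2 : ∀ᶠ w in 𝓝 z, sqNorm (coneScale m p (1 - ρ) w) < 1 :=
    (hF _).continuousAt.eventually_lt_const
      (sqNorm_coneScale_lt hp (by linarith) (by linarith) hz1)
  obtain ⟨w, ⟨⟨hw1, hw2⟩, hwW⟩, hwV, hwQ⟩ := hcl _ ((h1.and h2).and hW)
  -- The generic point `w` of the cone need not lie on the sphere. Its scalings by 1 - ρ and 1 + ρ
  -- lie on opposite sides of it, so some factor in between puts `w` on it.
  obtain ⟨r, ⟨hr1, hr2⟩, hr⟩ := intermediate_value_Icc (by linarith : 1 - ρ ≤ 1 + ρ)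
    (contDiff_sqNorm.continuous.comp (continuous_coneScale.comp
      (continuous_id.prodMk (continuous_const (y := w))))).continuousOn
    (⟨hw2.le, hw1.le⟩ : (1 : ℝ) ∈ Set.Icc _ _)
  have hr' : sqNorm (coneScale m p r w) = 1 := hr
  refine ⟨coneScale m p r w, hRW (hball ?_) hwW, ?_, coneScale_mem_genericSet (by linarith) hwQ⟩
  · rw [Real.dist_eq, abs_lt]
    constructor <;> linarith
  · rw [mem_ustilovsky_carrier, ← sum_pow_ustilovskyExp]
    exact ⟨hr', coneScale_mem_cone hwV⟩

end Density

/-! ### The integrals, their brackets and the invariant tori -/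

section Main

open Module Filter Topology

variable {m p : ℕ}

/-- The integrals of the contact flow of `H`: the functions `H` and `g_j`, the squared norms of the
pairs, `|z₁|²`, and the phases of all pairs but the first one. -/
def ustilovskyIntegral (ε : Fin m → ℝ) (q : Fin 3 × Fin m) : (Fin (2 * m + 2) → ℂ) → ℝ :=
  if q.1 = 0 then (if (q.2 : ℕ) = 0 then ustilovskyH ε else ustilovskyG q.2)
  else if q.1 = 1 then pairNormSq q.2
  else (if (q.2 : ℕ) = 0 then fun z => Complex.normSq (z 1) else pairPhase q.2)

theorem contDiff_ustilovskyIntegral (ε : Fin m → ℝ) (q : Fin 3 × Fin m) :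
    ContDiff ℝ ∞ (ustilovskyIntegral ε q) := by
  unfold ustilovskyIntegral
  split_ifs
  exacts [contDiff_ustilovskyH ε, contDiff_ustilovskyG _, contDiff_pairNormSq _,
    contDiff_normSq_coord 1, contDiff_pairPhase _]

theorem ustilovskyIntegral_torusAction (ε : Fin m → ℝ) (q : Fin 3 × Fin m)
    (t : Fin (m + 1) → ℝ) (z : Fin (2 * m + 2) → ℂ) :
    ustilovskyIntegral ε q (torusAction m p t z) = ustilovskyIntegral ε q z := by
  unfold ustilovskyIntegral
  split_ifs
  exacts [ustilovskyH_torusAction ε t z, ustilovskyG_torusAction p t z _,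
    pairNormSq_torusAction p t z _, normSq_torusAction_one p t z, pairPhase_torusAction _ t z]

/-- Where dF vanishes, dH = ∑ ε_j dg_j. This rewrites a combination of the integrals in terms of all
the dg_j. -/
theorem sum_fderiv_ustilovskyIntegral (hm : 0 < m) (ε : Fin m → ℝ) (c : Fin 3 × Fin m → ℝ)
    {z w : Fin (2 * m + 2) → ℂ} (hw : fderiv ℝ sqNorm z w = 0) :
    ∑ q, c q * fderiv ℝ (ustilovskyIntegral ε q) z w =
      ∑ j, ((c (0, ⟨0, hm⟩) * ε j + if (j : ℕ) = 0 then 0 else c (0, j)) *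
          fderiv ℝ (ustilovskyG j) z w +
        c (1, j) * fderiv ℝ (pairNormSq j) z w +
        (if (j : ℕ) = 0 then 0 else c (2, j)) * fderiv ℝ (pairPhase j) z w) +
      c (2, ⟨0, hm⟩) * fderiv ℝ (fun z : Fin (2 * m + 2) → ℂ => Complex.normSq (z 1)) z w := by
  have h0 : ∀ j : Fin m, (j : ℕ) = 0 ↔ j = ⟨0, hm⟩ := fun j => by rw [Fin.ext_iff]
  have e0 : ∑ j, c (0, j) * fderiv ℝ (ustilovskyIntegral ε (0, j)) z w =
      ∑ j, (c (0, ⟨0, hm⟩) * ε j + if (j : ℕ) = 0 then 0 else c (0, j)) *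
        fderiv ℝ (ustilovskyG j) z w := by
    have h1 : ∀ j : Fin m, c (0, j) * fderiv ℝ (ustilovskyIntegral ε (0, j)) z w =
        (if j = ⟨0, hm⟩ then c (0, ⟨0, hm⟩) * ∑ i, ε i * fderiv ℝ (ustilovskyG i) z w else 0) +
          (if (j : ℕ) = 0 then 0 else c (0, j)) * fderiv ℝ (ustilovskyG j) z w := by
      intro j
      by_cases hj : j = ⟨0, hm⟩
      · subst hj
        simp [ustilovskyIntegral, fderiv_ustilovskyH, hw]
      · have hj' := mt (h0 j).1 hj
        simp [ustilovskyIntegral, hj, hj']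
    simp only [h1, Finset.sum_add_distrib, Finset.sum_ite_eq', Finset.mem_univ, if_true, add_mul,
      Finset.mul_sum, mul_assoc]
  have e1 : ∀ j, ustilovskyIntegral ε (1, j) = pairNormSq j := fun j => by
    simp [ustilovskyIntegral]
  have e2 : ∑ j, c (2, j) * fderiv ℝ (ustilovskyIntegral ε (2, j)) z w =
      ∑ j : Fin m, (if (j : ℕ) = 0 then 0 else c (2, j)) * fderiv ℝ (pairPhase j) z w +
      c (2, ⟨0, hm⟩) *
        fderiv ℝ (fun z : Fin (2 * m + 2) → ℂ => Complex.normSq (z 1)) z w := by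
    have h1 : ∀ j : Fin m, c (2, j) * fderiv ℝ (ustilovskyIntegral ε (2, j)) z w =
        (if (j : ℕ) = 0 then 0 else c (2, j)) * fderiv ℝ (pairPhase j) z w +
        (if j = ⟨0, hm⟩ then c (2, ⟨0, hm⟩) *
          fderiv ℝ (fun z : Fin (2 * m + 2) → ℂ => Complex.normSq (z 1)) z w else 0) := by
      intro j
      by_cases hj : j = ⟨0, hm⟩
      · subst hj
        simp [ustilovskyIntegral]
      · have hj' := mt (h0 j).1 hj
        simp [ustilovskyIntegral, hj, hj']
    simp only [h1, Finset.sum_add_distrib, Finset.sum_ite_eq', Finset.mem_univ, if_true]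
  rw [Fintype.sum_prod_type, Fin.sum_univ_three, e0, e2]
  simp only [e1, Finset.sum_add_distrib]
  ring

/-- The integrals, indexed by `Fin (3 * m)`. -/
def ustilovskyIntegrals (ε : Fin m → ℝ) (i : Fin (3 * m)) : (Fin (2 * m + 2) → ℂ) → ℝ :=
  ustilovskyIntegral ε (finProdFinEquiv.symm i)

/-- The enumeration puts the block (0, ·) first, so the m integrals required to commute with all the
others are H and the g_j. -/
theorem ustilovskyIntegrals_of_lt (ε : Fin m → ℝ) {i : Fin (3 * m)} (hi : (i : ℕ) < m) :
    ustilovskyIntegrals ε i =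
      if (i : ℕ) = 0 then ustilovskyH ε else ustilovskyG ⟨i, hi⟩ := by
  have h : finProdFinEquiv.symm i = ((0 : Fin 3), (⟨i, hi⟩ : Fin m)) := by
    rw [Equiv.symm_apply_eq]
    exact Fin.ext (by simp [finProdFinEquiv])
  rw [ustilovskyIntegrals, h]
  simp [ustilovskyIntegral]

theorem independentAt_iff {ε : Fin m → ℝ} {z : Fin (2 * m + 2) → ℂ} :
    (ustilovsky m p).IndependentAt (ustilovskyIntegrals ε) z ↔
      ∀ c : Fin 3 × Fin m → ℝ, (∀ w ∈ (ustilovsky m p).tangent z,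
        ∑ q, c q * fderiv ℝ (ustilovskyIntegral ε q) z w = 0) → c = 0 := by
  have h := linearIndependent_equiv (R := ℝ) finProdFinEquiv.symm
    (f := fun q : Fin 3 × Fin m => ((fderiv ℝ (ustilovskyIntegral ε q) z :
      (Fin (2 * m + 2) → ℂ) →L[ℝ] ℝ) : (Fin (2 * m + 2) → ℂ) →ₗ[ℝ] ℝ).comp
        ((ustilovsky m p).tangent z).subtype)
  refine h.trans ?_
  rw [Fintype.linearIndependent_iff]
  refine forall_congr' fun c => ?_
  rw [funext_iff, LinearMap.ext_iff]
  simp [LinearMap.sum_apply]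

/-- A relation on the tangent space extends to a multiplier relation on the ambient space, to which
`coeff_eq_zero_of_generic` applies. The coefficient of the first g_j is that of H times the first ε,
so the change of coefficients is invertible. -/
theorem independentAt_of_mem_genericSet (hp : p ≠ 0) (hm : 0 < m) {ε : Fin m → ℝ}
    (hε : ε ⟨0, hm⟩ ≠ 0) {z : Fin (2 * m + 2) → ℂ} (hz : z ∈ genericSet m p) :
    (ustilovsky m p).IndependentAt (ustilovskyIntegrals ε) z := by
  rw [independentAt_iff]
  intro c hc
  set γ : Fin m → ℝ := fun j =>
    c (0, ⟨0, hm⟩) * ε j + if (j : ℕ) = 0 then 0 else c (0, j) with hγ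
  set τ : Fin m → ℝ := fun j => if (j : ℕ) = 0 then 0 else c (2, j) with hτ
  let L : (Fin (2 * m + 2) → ℂ) →ₗ[ℝ] ℝ :=
    ((∑ j, (γ j • fderiv ℝ (ustilovskyG j) z + c (1, j) • fderiv ℝ (pairNormSq j) z +
      τ j • fderiv ℝ (pairPhase j) z) + c (2, ⟨0, hm⟩) •
        fderiv ℝ (fun z : Fin (2 * m + 2) → ℂ => Complex.normSq (z 1)) z :
      (Fin (2 * m + 2) → ℂ) →L[ℝ] ℝ) : (Fin (2 * m + 2) → ℂ) →ₗ[ℝ] ℝ)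
  have hL : ∀ w, L w = ∑ j, (γ j * fderiv ℝ (ustilovskyG j) z w +
      c (1, j) * fderiv ℝ (pairNormSq j) z w + τ j * fderiv ℝ (pairPhase j) z w) +
      c (2, ⟨0, hm⟩) *
        fderiv ℝ (fun z : Fin (2 * m + 2) → ℂ => Complex.normSq (z 1)) z w := by
    intro w
    simp [L]
  obtain ⟨f, hf⟩ := exists_eq_comp_of_forall_ker
    (fderiv ℝ (ustilovsky m p).constraint z : (Fin (2 * m + 2) → ℂ) →ₗ[ℝ] ℝ × ℂ) L (by
      intro w hw
      rw [hL, ← sum_fderiv_ustilovskyIntegral hm ε c (fderiv_sqNorm_of_mem_tangent (p := p) hw)]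
      exact hc w hw)
  obtain ⟨l, μ, hlμ⟩ := exists_real_complex_functional f
  obtain ⟨h1, h2, h3, h4⟩ := coeff_eq_zero_of_generic hp hm hz (γ := γ) (η := fun j => c (1, j))
    (τ := τ) (σ := c (2, ⟨0, hm⟩)) (l := l) (μ := μ) (by simp [hτ]) (by
      intro w
      rw [← hL, hf]
      exact hlμ _ _)
  have h00 : c (0, ⟨0, hm⟩) = 0 := by
    have h := congrFun h1 ⟨0, hm⟩
    simp only [hγ, if_true, add_zero, Pi.zero_apply] at h
    exact (mul_eq_zero.1 h).resolve_right hε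
  ext ⟨i, j⟩
  rw [Pi.zero_apply]
  by_cases hj : j = ⟨0, hm⟩
  · subst hj
    fin_cases i
    exacts [h00, congrFun h2 _, h4]
  · have hj' : (j : ℕ) ≠ 0 := fun h => hj (Fin.ext h)
    fin_cases i
    · have h := congrFun h1 j
      simpa [hγ, h00, hj'] using h
    · exact congrFun h2 j
    · have h := congrFun h3 j
      simpa [hτ, hj'] using h

/-- Where the integrals are independent, so are the differentials of the `g_j`. -/
theorem eq_zero_of_sum_fderiv_ustilovskyG (hm : 0 < m) {ε : Fin m → ℝ} (hε : ε ⟨0, hm⟩ ≠ 0)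
    {z : Fin (2 * m + 2) → ℂ} (hz : (ustilovsky m p).IndependentAt (ustilovskyIntegrals ε) z)
    {s : Fin m → ℝ} (hs : ∀ w ∈ (ustilovsky m p).tangent z,
      ∑ j, s j * fderiv ℝ (ustilovskyG j) z w = 0) : s = 0 := by
  rw [independentAt_iff] at hz
  -- These coefficients come from eliminating the first differential: ε_0 dg_0 = dH - ∑_{j > 0} ε_j
  -- dg_j on tangent vectors.
  have h := hz (fun q => if q.1 = 0 then (if (q.2 : ℕ) = 0 then s q.2 / ε ⟨0, hm⟩ else
    s q.2 - s ⟨0, hm⟩ / ε ⟨0, hm⟩ * ε q.2) else 0) (by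
      intro w hw
      rw [sum_fderiv_ustilovskyIntegral hm ε _ (fderiv_sqNorm_of_mem_tangent hw)]
      refine Eq.trans ?_ (hs w hw)
      have h2 : (2 : Fin 3) ≠ 0 := by decide
      simp only [if_true, one_ne_zero, h2, if_false, zero_mul, add_zero, ite_self]
      refine Finset.sum_congr rfl fun j _ => ?_
      congr 1
      split_ifs with hj
      · rw [show j = ⟨0, hm⟩ from Fin.ext hj]
        field_simp
        ring
      · ring)
  have h0 : s ⟨0, hm⟩ = 0 := by
    have h1 := congrFun h (0, ⟨0, hm⟩)
    simp only [if_true, Pi.zero_apply] at h1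
    exact (div_eq_zero_iff.1 h1).resolve_right hε
  ext j
  by_cases hj : (j : ℕ) = 0
  · rw [show j = ⟨0, hm⟩ from Fin.ext hj]
    exact h0
  · have h1 := congrFun h (0, j)
    simpa [hj, h0] using h1

/-- The fundamental vector fields as a linear map. -/
def torusGeneratorL (m p : ℕ) (z : Fin (2 * m + 2) → ℂ) :
    (Fin (m + 1) → ℝ) →ₗ[ℝ] (Fin (2 * m + 2) → ℂ) where
  toFun v := torusGenerator m p v z
  map_add' u v := by
    simp only [torusGenerator, Pi.add_apply, add_smul, Finset.sum_add_distrib]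
    abel
  map_smul' c v := by
    simp only [torusGenerator, Pi.smul_apply, smul_eq_mul, mul_smul, smul_add, Finset.smul_sum,
      RingHom.id_apply]

section Regular

variable {ε : Fin m → ℝ} {z : Fin (2 * m + 2) → ℂ}

/-- If X_v = 0, then ∑ v_j dg_j = -dα(X_v, ·) = 0 on the tangent space, so the rotation components
of v vanish. Applying α to the remaining multiple of Z gives the last one. -/
theorem torusGeneratorL_injective (hp : p ≠ 0) (hm : 0 < m) (hε : ε ⟨0, hm⟩ ≠ 0)
    (hz : z ∈ (ustilovsky m p).carrier)
    (hind : (ustilovsky m p).IndependentAt (ustilovskyIntegrals ε) z) :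
    Function.Injective (torusGeneratorL m p z) := by
  rw [injective_iff_map_eq_zero]
  intro v hv
  have hv' : torusGenerator m p v z = 0 := hv
  have hs : (fun j : Fin m => v j.succ) = 0 := by
    refine eq_zero_of_sum_fderiv_ustilovskyG hm hε hind fun w hw => ?_
    have h := dform_torusGenerator hp hw v
    rw [hv'] at h
    rw [← neg_eq_zero, ← h]
    simp [FormOnLevelSet.dform]
  have hs' : ∀ j : Fin m, v j.succ = 0 := fun j => congrFun hs j
  have h0 : v 0 = 0 := by
    have h := congrArg ((ustilovsky m p).form z) hv'
    simpa [torusGenerator, hs', form_ustilovskyReeb hp hz] using h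
  ext i
  exact Fin.cases h0 hs' i

theorem fderiv_ustilovskyIntegral_torusGenerator (ε : Fin m → ℝ) (q : Fin 3 × Fin m)
    (v : Fin (m + 1) → ℝ) (z : Fin (2 * m + 2) → ℂ) :
    fderiv ℝ (ustilovskyIntegral ε q) z (torusGenerator m p v z) = 0 :=
  fderiv_torusGenerator_eq_zero ((contDiff_ustilovskyIntegral ε q).differentiable (by simp) z)
    (ustilovskyIntegral_torusAction ε q) v

/-- At regular points the common kernel of the differentials of the integrals is the tangent space
of the orbit. -/
theorem exists_torusGenerator_eq (hp : p ≠ 0) (hm : 0 < m) (hε : ε ⟨0, hm⟩ ≠ 0)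
    (hz : z ∈ (ustilovsky m p).carrier)
    (hind : (ustilovsky m p).IndependentAt (ustilovskyIntegrals ε) z)
    {w : Fin (2 * m + 2) → ℂ} (hw : w ∈ (ustilovsky m p).tangent z)
    (hwF : ∀ i, fderiv ℝ (ustilovskyIntegrals ε i) z w = 0) :
    ∃ v, torusGenerator m p v z = w := by
  set T := (ustilovsky m p).tangent z
  set l : Fin (3 * m) → T →ₗ[ℝ] ℝ := fun i =>
    ((fderiv ℝ (ustilovskyIntegrals ε i) z : (Fin (2 * m + 2) → ℂ) →L[ℝ] ℝ) :
      (Fin (2 * m + 2) → ℂ) →ₗ[ℝ] ℝ).comp T.subtype with hl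
  have hmem : ∀ x : T, x ∈ (Submodule.span ℝ (Set.range l)).dualCoannihilator ↔
      ∀ i, l i x = 0 := by
    intro x
    rw [Submodule.mem_dualCoannihilator]
    refine ⟨fun h i => h _ (Submodule.subset_span ⟨i, rfl⟩), fun h φ hφ => ?_⟩
    induction hφ using Submodule.span_induction with
    | mem φ hφ => obtain ⟨i, rfl⟩ := hφ; exact h i
    | zero => rfl
    | add φ ψ _ _ h1 h2 => rw [LinearMap.add_apply, h1, h2, add_zero]
    | smul c φ _ h1 => rw [LinearMap.smul_apply, h1, smul_zero]
  have hrank := LinearIndependent.finrank_dualCoannihilator (l := l) hind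
  rw [(isContact_ustilovsky m hp).dimension z hz] at hrank
  let D : (Fin (m + 1) → ℝ) →ₗ[ℝ] T :=
    (torusGeneratorL m p z).codRestrict T fun v => torusGenerator_mem_tangent hp hz v
  have hD : Function.Injective D := fun u v h =>
    torusGeneratorL_injective hp hm hε hz hind (congrArg Subtype.val h)
  have hle : LinearMap.range D ≤ (Submodule.span ℝ (Set.range l)).dualCoannihilator := by
    rintro _ ⟨v, rfl⟩
    rw [hmem]
    exact fun i => fderiv_ustilovskyIntegral_torusGenerator ε _ v z
  -- Invariance gives one inclusion, and the dimensions agree: (4m + 1) - 3m = m + 1.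
  have heq := Submodule.eq_of_le_of_finrank_eq hle (by
    rw [LinearMap.finrank_range_of_inj hD, Module.finrank_fin_fun]
    omega)
  have hwD : (⟨w, hw⟩ : T) ∈ LinearMap.range D := by
    rw [heq, hmem]
    exact hwF
  obtain ⟨v, hv⟩ := hwD
  exact ⟨v, congrArg Subtype.val hv⟩

/-- The level set is a fibre of the constraint together with the integrals, and the kernel of the
differential of this map at `z` is the tangent space of the orbit. -/
theorem eventually_mem_orbit (hp : p ≠ 0) (hm : 0 < m) (hε : ε ⟨0, hm⟩ ≠ 0)
    (hz : z ∈ (ustilovsky m p).carrier)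
    (hind : (ustilovsky m p).IndependentAt (ustilovskyIntegrals ε) z) :
    ∀ᶠ w in 𝓝 z, w ∈ {w ∈ (ustilovsky m p).carrier |
      ∀ i, ustilovskyIntegrals ε i w = ustilovskyIntegrals ε i z} →
        w ∈ Set.range fun t => torusAction m p t z := by
  have h0 : torusAction m p 0 z = z := by
    rw [torusAction_zero]
    rfl
  have hGs : ContDiff ℝ ∞ fun w => ((ustilovsky m p).constraint w,
      fun i => ustilovskyIntegrals ε i w) :=
    (isContact_ustilovsky m hp).smooth_constraint.prodMk
      (contDiff_pi.2 fun i => contDiff_ustilovskyIntegral ε _)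
  have hφ := (contDiff_torusAction (p := p) z).contDiffAt.hasStrictFDerivAt (x := 0) (by simp)
  have hG := hGs.contDiffAt.hasStrictFDerivAt (x := torusAction m p 0 z) (by simp)
  have hG' : ∀ v, fderiv ℝ (fun w => ((ustilovsky m p).constraint w,
      fun i => ustilovskyIntegrals ε i w)) z v =
      (fderiv ℝ (ustilovsky m p).constraint z v,
        fun i => fderiv ℝ (ustilovskyIntegrals ε i) z v) := by
    intro v
    have h1 := (((isContact_ustilovsky m hp).smooth_constraint).differentiable
      (by simp) z).hasFDerivAt.prodMk (hasFDerivAt_pi.2 fun i =>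
        ((contDiff_ustilovskyIntegral ε (finProdFinEquiv.symm i)).differentiable
          (by simp) z).hasFDerivAt)
    have h2 : HasFDerivAt (fun w => ((ustilovsky m p).constraint w,
      fun i => ustilovskyIntegrals ε i w)) _ z := h1
    rw [h2.fderiv]
    rfl
  have h := hG.eventually_mem_range_of_fibre (φ := fun t => torusAction m p t z) hφ ?_ ?_ ?_
  · simp only [h0] at h
    filter_upwards [h] with w hw hwS
    refine hw (Prod.ext ?_ (funext hwS.2))
    exact hwS.1.trans hz.symm
  · intro u v huv
    rw [fderiv_torusAction, fderiv_torusAction, h0] at huv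
    exact torusGeneratorL_injective hp hm hε hz hind huv
  · intro v hv
    rw [h0, hG', Prod.mk_eq_zero, funext_iff] at hv
    obtain ⟨u, hu⟩ := exists_torusGenerator_eq hp hm hε hz hind hv.1 hv.2
    refine ⟨u, ?_⟩
    rw [fderiv_torusAction, h0, hu]
  · intro s
    refine Prod.ext ?_ (funext fun i => ?_)
    · exact (torusAction_mem_carrier hp hz : _ = _).trans (torusAction_mem_carrier hp hz).symm
    · simp only [ustilovskyIntegrals, ustilovskyIntegral_torusAction]

theorem torusAction_injective (t : Fin (m + 1) → ℝ) :
    Function.Injective (torusAction m p t) := by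
  intro u v huv
  have h : ∀ x, torusAction m p (-t) (torusAction m p t x) = x := by
    intro x
    rw [← ContinuousLinearMap.comp_apply, ← torusAction_add, neg_add_cancel, torusAction_zero]
    rfl
  rw [← h u, huv, h]

theorem exists_invariant_torus (hp : p ≠ 0) (hm : 0 < m) (hε : ε ⟨0, hm⟩ ≠ 0)
    (hz : z ∈ (ustilovsky m p).carrier)
    (hind : (ustilovsky m p).IndependentAt (ustilovskyIntegrals ε) z) :
    ∃ φ : (Fin (m + 1) → ℝ) → (Fin (2 * m + 2) → ℂ),
      (ustilovsky m p).IsPreIsotropicTorus (m + 1) φ ∧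
      Set.range φ = connectedComponentIn {w ∈ (ustilovsky m p).carrier |
        ∀ i, ustilovskyIntegrals ε i w = ustilovskyIntegrals ε i z} z ∧
      ∃ B : (Fin (m + 1) → ℝ) ≃ₗ[ℝ] (Fin (m + 1) → ℝ), ∀ θ v,
        fderiv ℝ φ θ v = torusGenerator m p (B v) (φ θ) := by
  have h0 : torusAction m p 0 z = z := by
    rw [torusAction_zero]
    rfl
  have hcont : Continuous fun t => torusAction m p t z := (contDiff_torusAction z).continuous
  have hφ := (contDiff_torusAction (p := p) z).contDiffAt.hasStrictFDerivAt (x := 0) (by simp)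
  obtain ⟨hcomp, b, hb⟩ := exists_basis_orbit (torusAction_zero p)
    (fun s t => torusAction_add p t s) hφ
    (by
      intro u v huv
      rw [fderiv_torusAction, fderiv_torusAction, h0] at huv
      exact torusGeneratorL_injective hp hm hε hz hind huv) hcont
    (torusPeriod m p) (torusPeriod_ne_zero hp) (fun i => torusAction_period hp i z)
  have hrange := range_orbit_eq_connectedComponentIn
    (S := {w ∈ (ustilovsky m p).carrier |
      ∀ i, ustilovskyIntegrals ε i w = ustilovskyIntegrals ε i z}) (z := z) ⟨hz, fun _ => rfl⟩
    (fun t w hw => ⟨torusAction_mem_carrier hp hw.1, fun i => by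
      rw [← hw.2 i, ustilovskyIntegrals, ustilovskyIntegral_torusAction]⟩) hcont hcomp.isClosed
    (eventually_mem_orbit hp hm hε hz hind) (torusAction_zero p) (fun s t => torusAction_add p t s)
  -- In the coordinates of a ℤ-basis of the stabiliser the orbit map has period lattice exactly
  -- ℤ^(m+1).
  let B := b.equivFun.symm
  have hBs : ContDiff ℝ ∞ B := (LinearMap.toContinuousLinearMap B.toLinearMap).contDiff
  have hs : ContDiff ℝ ∞ fun θ => torusAction m p (B θ) z := (contDiff_torusAction z).comp hBs
  have hder : ∀ θ v, fderiv ℝ (fun θ => torusAction m p (B θ) z) θ v =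
      fderiv ℝ (fun t => torusAction m p t z) (B θ) (B v) := by
    intro θ v
    have h1 : HasFDerivAt B (LinearMap.toContinuousLinearMap B.toLinearMap) θ :=
      (LinearMap.toContinuousLinearMap B.toLinearMap).hasFDerivAt
    have h2 : HasFDerivAt (fun θ => torusAction m p (B θ) z) _ θ :=
      ((contDiff_torusAction (p := p) z).differentiable (by simp) (B θ)).hasFDerivAt.comp θ h1
    rw [h2.fderiv]
    rfl
  have hgen : ∀ θ v, fderiv ℝ (fun θ => torusAction m p (B θ) z) θ v =
      torusGenerator m p (B v) (torusAction m p (B θ) z) := fun θ v => by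
    rw [hder, fderiv_torusAction]
  have hmem : ∀ θ, torusAction m p (B θ) z ∈ (ustilovsky m p).carrier := fun θ =>
    torusAction_mem_carrier hp hz
  refine ⟨fun θ => torusAction m p (B θ) z, ⟨hs, ?_, ?_, hmem, ?_, ?_⟩, ?_, B, hgen⟩
  -- Independence is assumed only at `z`; injectivity of the derivative elsewhere is carried over by
  -- the invertible maps of the action.
  · intro θ u v huv
    rw [hder, hder, fderiv_torusAction_eq_action, fderiv_torusAction_eq_action] at huv
    exact B.injective (torusGeneratorL_injective hp hm hε hz hind (torusAction_injective _ huv))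
  · intro θ θ'
    have h1 : B θ' = B θ + B (θ' - θ) := by rw [← map_add, add_sub_cancel]
    have h2 : ∀ i, b.repr (B (θ' - θ)) i = θ' i - θ i := by
      intro i
      have h3 : b.equivFun (B (θ' - θ)) = θ' - θ := b.equivFun.apply_symm_apply _
      exact congrFun h3 i
    have h3 : torusAction m p (B θ) z = torusAction m p (B θ') z ↔
        torusAction m p (B (θ' - θ)) z = z := by
      rw [h1, torusAction_add, ContinuousLinearMap.comp_apply]
      exact ⟨fun h => (torusAction_injective _ h).symm, fun h => by rw [h]⟩
    rw [h3, hb]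
    refine exists_congr fun k => forall_congr' fun i => ?_
    rw [h2, sub_eq_iff_eq_add, add_comm]
  · intro θ
    refine ⟨B.symm (Pi.single 0 1), ?_⟩
    rw [hgen, LinearEquiv.apply_symm_apply, torusGenerator_single_zero,
      form_ustilovskyReeb hp (hmem θ)]
    exact one_ne_zero
  -- dα vanishes on the whole tangent space of the orbit, because each dg_j vanishes along it.
  · intro θ u v _ _
    rw [hgen, hgen, dform_torusGenerator hp (torusGenerator_mem_tangent hp (hmem θ) _),
      neg_eq_zero]
    refine Finset.sum_eq_zero fun j _ => ?_
    rw [fderiv_torusGenerator_eq_zero ((contDiff_ustilovskyG j).differentiable (by simp) _)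
      (fun t z => ustilovskyG_torusAction p t z j), mul_zero]
  · rw [← hrange]
    exact B.surjective.range_comp (fun t => torusAction m p t z)

end Regular

theorem fderiv_contactField_ustilovskyG_eq_zero (hp : p ≠ 0)
    {f : (Fin (2 * m + 2) → ℂ) → ℝ} (hf : ContDiff ℝ ∞ f)
    (hinv : ∀ t z, f (torusAction m p t z) = f z) {z : Fin (2 * m + 2) → ℂ}
    (hz : z ∈ (ustilovsky m p).carrier) (j : Fin m) :
    fderiv ℝ f z ((ustilovsky m p).contactField (ustilovskyG j) z) = 0 := by
  rw [contactField_ustilovskyG hp hz, ← torusGenerator_single_succ (p := p)]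
  exact fderiv_torusGenerator_eq_zero (hf.differentiable (by simp) z) hinv _

theorem fderiv_contactField_ustilovskyH_eq_zero (hp : p ≠ 0) (ε : Fin m → ℝ)
    {f : (Fin (2 * m + 2) → ℂ) → ℝ} (hf : ContDiff ℝ ∞ f)
    (hinv : ∀ t z, f (torusAction m p t z) = f z) {z : Fin (2 * m + 2) → ℂ}
    (hz : z ∈ (ustilovsky m p).carrier) :
    fderiv ℝ f z ((ustilovsky m p).contactField (ustilovskyH ε) z) = 0 := by
  rw [contactField_ustilovskyH hp hz]
  exact fderiv_torusGenerator_eq_zero (hf.differentiable (by simp) z) hinv _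

theorem fderiv_reeb_eq_zero (hp : p ≠ 0) {f : (Fin (2 * m + 2) → ℂ) → ℝ}
    (hf : ContDiff ℝ ∞ f) (hinv : ∀ t z, f (torusAction m p t z) = f z)
    {z : Fin (2 * m + 2) → ℂ} (hz : z ∈ (ustilovsky m p).carrier) :
    fderiv ℝ f z ((ustilovsky m p).reeb z) = 0 := by
  rw [reeb_ustilovsky hp hz]
  exact fderiv_ustilovskyReeb_eq_zero (hf.differentiable (by simp) z) hinv

theorem bracket_one_eq_zero (hp : p ≠ 0) {f : (Fin (2 * m + 2) → ℂ) → ℝ}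
    (hf : ContDiff ℝ ∞ f) (hinv : ∀ t z, f (torusAction m p t z) = f z)
    {z : Fin (2 * m + 2) → ℂ} (hz : z ∈ (ustilovsky m p).carrier) :
    (ustilovsky m p).bracket (fun _ => 1) f z = 0 := by
  rw [(isContact_ustilovsky m hp).bracket_one_eq f hz, fderiv_reeb_eq_zero hp hf hinv hz]

/-- By Reeb invariance [f, g_j] = Y_f(g_j) = -Y_{g_j}(f), and Y_{g_j} is tangent to the orbits on
which f is constant. No description of Y_f itself is needed. -/
theorem bracket_ustilovskyG_eq_zero (hp : p ≠ 0) {f : (Fin (2 * m + 2) → ℂ) → ℝ}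
    (hf : ContDiff ℝ ∞ f) (hinv : ∀ t z, f (torusAction m p t z) = f z)
    {z : Fin (2 * m + 2) → ℂ} (hz : z ∈ (ustilovsky m p).carrier) (j : Fin m) :
    (ustilovsky m p).bracket f (ustilovskyG j) z = 0 := by
  have hfZ := fderiv_reeb_eq_zero hp hf hinv hz
  rw [FormOnLevelSet.bracket_of_fderiv_reeb_eq_zero _ hfZ,
    (isContact_ustilovsky m hp).fderiv_contactField_comm hz hfZ
      (fderiv_reeb_eq_zero hp (contDiff_ustilovskyG j)
        (fun t z => ustilovskyG_torusAction p t z j) hz),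
    fderiv_contactField_ustilovskyG_eq_zero hp hf hinv hz, neg_zero]

theorem bracket_ustilovskyH_eq_zero (hp : p ≠ 0) (ε : Fin m → ℝ)
    {f : (Fin (2 * m + 2) → ℂ) → ℝ}
    (hf : ContDiff ℝ ∞ f) (hinv : ∀ t z, f (torusAction m p t z) = f z)
    {z : Fin (2 * m + 2) → ℂ} (hz : z ∈ (ustilovsky m p).carrier) :
    (ustilovsky m p).bracket f (ustilovskyH ε) z = 0 := by
  have hfZ := fderiv_reeb_eq_zero hp hf hinv hz
  rw [FormOnLevelSet.bracket_of_fderiv_reeb_eq_zero _ hfZ,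
    (isContact_ustilovsky m hp).fderiv_contactField_comm hz hfZ
      (fderiv_reeb_eq_zero hp (contDiff_ustilovskyH ε) (ustilovskyH_torusAction ε) hz),
    fderiv_contactField_ustilovskyH_eq_zero hp ε hf hinv hz, neg_zero]

theorem isNoncommutativelyIntegrable_ustilovsky (hp : p ≠ 0) (hm : 0 < m) {ε : Fin m → ℝ}
    (hε : ε ⟨0, hm⟩ ≠ 0) :
    (ustilovsky m p).IsNoncommutativelyIntegrable (2 * m) m (ustilovskyH ε)
      (ustilovskyIntegrals ε) where
  contact := isContact_ustilovsky m hp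
  count := by omega
  le := by omega
  smooth i := contDiff_ustilovskyIntegral ε _
  hamiltonian := Or.inl ⟨by omega, hm, fun z _ => by
    rw [ustilovskyIntegrals_of_lt ε hm]
    rfl⟩
  isIntegral i z hz := fderiv_contactField_ustilovskyH_eq_zero hp ε
    (contDiff_ustilovskyIntegral ε _) (ustilovskyIntegral_torusAction ε _) hz
  bracket_one i z hz := bracket_one_eq_zero hp (contDiff_ustilovskyIntegral ε _)
    (ustilovskyIntegral_torusAction ε _) hz
  bracket_eq_zero i j hj z hz := by
    rw [ustilovskyIntegrals_of_lt ε hj]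
    split_ifs
    · exact bracket_ustilovskyH_eq_zero hp ε (contDiff_ustilovskyIntegral ε _)
        (ustilovskyIntegral_torusAction ε _) hz
    · exact bracket_ustilovskyG_eq_zero hp (contDiff_ustilovskyIntegral ε _)
        (ustilovskyIntegral_torusAction ε _) hz _
  independent := ⟨genericSet m p, isOpen_genericSet m p, carrier_subset_closure_generic hp hm,
    fun _ hz => independentAt_of_mem_genericSet hp hm hε hz.2⟩

theorem range_torusGeneratorL (z : Fin (2 * m + 2) → ℂ) :
    LinearMap.range (torusGeneratorL m p z) =
      Submodule.span ℝ (insert (ustilovskyReeb m p z)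
        (Set.range fun j : Fin m => rotationField j z)) := by
  apply le_antisymm
  · rintro _ ⟨v, rfl⟩
    exact Submodule.add_mem _
      (Submodule.smul_mem _ _ (Submodule.subset_span (Set.mem_insert _ _)))
      (Submodule.sum_mem _ fun j _ => Submodule.smul_mem _ _
        (Submodule.subset_span (Set.mem_insert_of_mem _ ⟨j, rfl⟩)))
  · rw [Submodule.span_le, Set.insert_subset_iff]
    refine ⟨⟨_, torusGenerator_single_zero z⟩, ?_⟩
    rintro _ ⟨j, rfl⟩
    exact ⟨_, torusGenerator_single_succ j z⟩

end Main

end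

theorem proposition4p3 (m p : ℕ) (hm : 0 < m) (hp : p % 8 = 1 ∨ p % 8 = 7)
    (ε : Fin m → ℝ) (hε : ∀ j, 0 < ε j ∧ ε j < 1) :
    -- `B_p` is a contact manifold of dimension `4 m + 1`, and the contact flow of `H` on it is
    -- noncommutatively integrable, through `3 m` integrals, with `r = m`
    ∃ F : Fin (3 * m) → (Fin (2 * m + 2) → ℂ) → ℝ,
      (ustilovsky m p).IsNoncommutativelyIntegrable (2 * m) m (ustilovskyH ε) F ∧
      -- the `g_j` are integrals of it, commuting with `1`, with each other and with all `F i`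
      (∀ j, (ustilovsky m p).IsIntegralOf (ustilovskyH ε) (ustilovskyG j)) ∧
      (∀ j, ∀ z ∈ (ustilovsky m p).carrier,
        (ustilovsky m p).bracket (fun _ => 1) (ustilovskyG j) z = 0) ∧
      (∀ i j, ∀ z ∈ (ustilovsky m p).carrier,
        (ustilovsky m p).bracket (ustilovskyG i) (ustilovskyG j) z = 0) ∧
      (∀ i j, ∀ z ∈ (ustilovsky m p).carrier,
        (ustilovsky m p).bracket (F i) (ustilovskyG j) z = 0) ∧
      -- through every regular point, the connected component of the common level set of the
      -- integrals is a pre-isotropic torus `T` of dimension `m + 1`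
      ∀ z ∈ (ustilovsky m p).carrier, (ustilovsky m p).IndependentAt F z →
        ∃ φ : (Fin (m + 1) → ℝ) → (Fin (2 * m + 2) → ℂ),
          (ustilovsky m p).IsPreIsotropicTorus (m + 1) φ ∧
          Set.range φ =
            connectedComponentIn {w ∈ (ustilovsky m p).carrier | ∀ i, F i w = F i z} z ∧
          -- its tangent spaces are spanned by `Z` and `Y_{g_1}, …, Y_{g_m}`
          (∀ θ, LinearMap.range ((fderiv ℝ φ θ : (Fin (m + 1) → ℝ) →L[ℝ] _) :
                (Fin (m + 1) → ℝ) →ₗ[ℝ] (Fin (2 * m + 2) → ℂ)) =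
            Submodule.span ℝ (insert ((ustilovsky m p).reeb (φ θ))
              (Set.range fun j : Fin m =>
                (ustilovsky m p).contactField (ustilovskyG j) (φ θ)))) ∧
          -- the flows of `Z`, `Y_{g_j}` and `Y_H` act on it by translations
          (∃ c, ∀ θ, fderiv ℝ φ θ c = (ustilovsky m p).reeb (φ θ)) ∧
          (∀ j, ∃ c, ∀ θ, fderiv ℝ φ θ c =
            (ustilovsky m p).contactField (ustilovskyG j) (φ θ)) ∧
          (∃ c, ∀ θ, fderiv ℝ φ θ c =
            (ustilovsky m p).contactField (ustilovskyH ε) (φ θ)) := by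
  have hp0 : p ≠ 0 := by omega
  have hε0 : ε ⟨0, hm⟩ ≠ 0 := (hε _).1.ne'
  refine ⟨ustilovskyIntegrals ε, isNoncommutativelyIntegrable_ustilovsky hp0 hm hε0,
    fun j z hz => fderiv_contactField_ustilovskyH_eq_zero hp0 ε (contDiff_ustilovskyG j)
      (fun t z => ustilovskyG_torusAction p t z j) hz,
    fun j z hz => bracket_one_eq_zero hp0 (contDiff_ustilovskyG j)
      (fun t z => ustilovskyG_torusAction p t z j) hz,
    fun i j z hz => bracket_ustilovskyG_eq_zero hp0 (contDiff_ustilovskyG i)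
      (fun t z => ustilovskyG_torusAction p t z i) hz j,
    fun i j z hz => bracket_ustilovskyG_eq_zero hp0 (contDiff_ustilovskyIntegral ε _)
      (ustilovskyIntegral_torusAction ε _) hz j, fun z hz hind => ?_⟩
  obtain ⟨φ, hφ, hrange, B, hB⟩ := exists_invariant_torus hp0 hm hε0 hz hind
  -- Z, Y_{g_j} and Y_H are fundamental fields with coefficients independent of the point, so
  -- `B.symm` turns them into constant fields on the torus.
  refine ⟨φ, hφ, hrange, fun θ => ?_, ⟨B.symm (Pi.single 0 1), fun θ => ?_⟩,
    fun j => ⟨B.symm (Pi.single j.succ 1), fun θ => ?_⟩, ⟨B.symm (Fin.cons 1 ε), fun θ => ?_⟩⟩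
  · have h1 : ((fderiv ℝ φ θ : (Fin (m + 1) → ℝ) →L[ℝ] _) :
        (Fin (m + 1) → ℝ) →ₗ[ℝ] (Fin (2 * m + 2) → ℂ)) =
        (torusGeneratorL m p (φ θ)).comp B.toLinearMap := LinearMap.ext (hB θ)
    rw [h1, LinearMap.range_comp_of_range_eq_top _ (LinearEquiv.range B), range_torusGeneratorL,
      reeb_ustilovsky hp0 (hφ.mem θ)]
    simp only [contactField_ustilovskyG hp0 (hφ.mem θ)]
  · rw [hB, LinearEquiv.apply_symm_apply, torusGenerator_single_zero,
      reeb_ustilovsky hp0 (hφ.mem θ)]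
  · rw [hB, LinearEquiv.apply_symm_apply, torusGenerator_single_succ,
      contactField_ustilovskyG hp0 (hφ.mem θ)]
  · rw [hB, LinearEquiv.apply_symm_apply, contactField_ustilovskyH hp0 (hφ.mem θ)]
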